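/- Let $\Omega$ be a locally compact Hausdorff space, let $T_1,\dots,T_k:\Omega\to\Omega$ be pairwise commuting local homeomorphisms, and put $\Theta_m=T_1^{m_1}\cdots T_k^{m_k}$ for $m\in\mathbb N^k$ (where $0\in\mathbb N$). Let $\Lambda$ be the associated topological $k$-graph: its vertex space is $\Omega$, its paths are the pairs $(n,x)\in\mathbb N^k\times\Omega$, with $r(n,x)=x$, $s(n,x)=\Theta_n(x)$, degree $d(n,x)=n$ and composition $(n,x)(m,\Theta_n(x))=(n+m,x)$. Let $X^\Lambda$ be the topological $k$-graph correspondence of $\Lambda$, that is, the product system over $\mathbb N^k$ of $C_0(\Omega)$-correspondences whose fibre $X_m$ is the completion of $C_c(\{m\}\times\Omega)$ (concretely, the continuous functions $\xi$ on $\{m\}\times\Omega$ such that $x\mapsto\sum_{\Theta_m(y)=x}|\xi(m,y)|^2$ is a well-defined element of $C_0(\Omega)$) with $$(f\cdot\xi\cdot g)(m,x)=f(x)\,\xi(m,x)\,g(\Theta_m(x)),\qquad \langle\xi,\eta\rangle_m(x)=\sum_{\Theta_m(y)=x}\overline{\xi(m,y)}\,\eta(m,y),$$ and multiplication $(\xi\eta)(m+n,x)=\xi(m,x)\,\eta(n,\Theta_m(x))$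 for $\xi\in X_m$, $\eta\in X_n$; $X_0$ is identified with $C_0(\Omega)$. Notation. $\phi_m:C_0(\Omega)\to\mathcal L(X_m)$ is the left action, and $\mathcal K(X_m)$ is the closed linear span of the operators $\theta_{\xi,\eta}:\zeta\mapsto\xi\cdot\langle\eta,\zeta\rangle_m$. For $p\le q$, $\iota_p^q(S)$ is the operator on $X_q$ with $\iota_p^q(S)(\xi\eta)=S(\xi)\eta$ for $\xi\in X_p$, $\eta\in X_{q-p}$, and $\iota_p^q(S)=0$ if $p\not\le q$. Put $I_m=\bigcap_{0\ne r\le m}\ker\phi_r$ (so $I_0=C_0(\Omega)$) and $\widetilde X_q=\bigoplus_{p\le q}X_p\cdot I_{q-p}$, with left action $(\widetilde\phi_q(a)\xi)(p)=\phi_p(a)\xi(p)$, and let $(\widetilde\iota_p^{\,q}(S)\xi)(r)=\iota_p^r(S)\xi(r)$. A (Toeplitz) representation $\psi$ of $X^\Lambda$ in a $C^*$-algebra $B$ consists of linear maps $\psi_m:X_m\to B$ such that $\psi_0$ is a $*$-homomorphism on $C_0(\Omega)$, $\psi_m(\xi)^*\psi_m(\eta)=\psi_0(\langle\xi,\eta\rangle_m)$,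 $\psi_m(f\cdot\xi\cdot g)=\psi_0(f)\psi_m(\xi)\psi_0(g)$ and $\psi_{m+n}(\xi\eta)=\psi_m(\xi)\psi_n(\eta)$; $\psi^{(m)}:\mathcal K(X_m)\to B$ is the homomorphism with $\psi^{(m)}(\theta_{\xi,\eta})=\psi_m(\xi)\psi_m(\eta)^*$. The representation $\psi$ is Cuntz--Pimsner covariant in the sense of (CP-K) if $\psi^{(m)}(\phi_m(a))=\psi_0(a)$ for all $m\in\mathbb N^k$ and all $a\in\phi_m^{-1}(\mathcal K(X_m))\cap(\ker\phi_m)^\perp$. It is CNP-covariant (Cuntz--Nica--Pimsner covariant) if both of the following hold: (N) $\psi^{(p)}(S)\psi^{(q)}(T)=\psi^{(p\vee q)}\big(\iota_p^{p\vee q}(S)\,\iota_q^{p\vee q}(T)\big)$ for all $p,q\in\mathbb N^k$, $S\in\mathcal K(X_p)$, $T\in\mathcal K(X_q)$; (CP-SY) for every finite $F\subset\mathbb N^k$ and every choice of $T_p\in\mathcal K(X_p)$ $(p\in F)$ such that $\sum_{p\in F}\widetilde\iota_p^{\,s}(T_p)=0$ for large $s$ (that is, for every $q$ there is $r\ge q$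 such that the equality holds for all $s\ge r$), one has $\sum_{p\in F}\psi^{(p)}(T_p)=0$. Proposition. CNP-covariance is a meaningful notion for $X^\Lambda$: the product system $X^\Lambda$ is compactly aligned, i.e. $\iota_p^{p\vee q}(S)\,\iota_q^{p\vee q}(T)\in\mathcal K(X_{p\vee q})$ for all $p,q\in\mathbb N^k$, $S\in\mathcal K(X_p)$, $T\in\mathcal K(X_q)$, and $\widetilde\phi_q$ is injective for every $q\in\mathbb N^k$. Moreover, a (Toeplitz) representation $\psi$ of $X^\Lambda$ in a $C^*$-algebra $B$ is Cuntz--Pimsner covariant in the sense of (CP-K) if and only if it is CNP-covariant. -/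

import Mathlib

open scoped ZeroAtInfty ComplexOrder ComplexConjugate
open Filter Topology

/-- A topological graph: `V` is the vertex space, `E` the edge space. -/
structure TopGraph (V E : Type*) [TopologicalSpace V] [TopologicalSpace E] where
  r : E → V
  s : E → V
  continuous_r : Continuous r
  isLocalHomeomorph_s : IsLocalHomeomorph s

section C0Order

variable {V : Type*} [TopologicalSpace V]

/-- The pointwise order on `C₀(V)`. -/
noncomputable instance czeroPartialOrder : PartialOrder C₀(V, ℂ) :=
  PartialOrder.lift (fun f => (f : V → ℂ)) DFunLike.coe_injective

theorem czero_le_iff {f g : C₀(V, ℂ)} : f ≤ g ↔ ∀ v, f v ≤ g v := Iff.rfl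

instance czeroStarOrderedRing : StarOrderedRing C₀(V, ℂ) :=
  StarOrderedRing.of_nonneg_iff'
    (fun {x y} h z v => by
      simpa using add_le_add_right (h v) (z v))
    (fun f => by
      constructor
      · intro h
        have h' : ∀ v, (0 : ℂ) ≤ f v := h
        refine ⟨⟨⟨fun v => ((Real.sqrt (f v).re : ℝ) : ℂ), by fun_prop⟩, ?_⟩, ?_⟩
        · have h1 := f.zero_at_infty'
          have h2 : Continuous fun z : ℂ => ((Real.sqrt z.re : ℝ) : ℂ) := by fun_prop
          have := (h2.tendsto 0).comp h1
          simpa [Function.comp_def] using this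
        · ext v
          have h3 := Complex.nonneg_iff.1 (h' v)
          change f v = star ((Real.sqrt (f v).re : ℝ) : ℂ) * ((Real.sqrt (f v).re : ℝ) : ℂ)
          rw [Complex.star_def, Complex.conj_ofReal, ← Complex.ofReal_mul, Real.mul_self_sqrt h3.1]
          apply Complex.ext <;> simp [← h3.2]
      · rintro ⟨s, rfl⟩ v
        exact star_mul_self_nonneg (s v))

end C0Order

theorem hasSum_of_eq {ι M : Type*} [AddCommMonoid M] [TopologicalSpace M] {f g : ι → M} {a b : M}
    (h : HasSum f a) (hfg : ∀ i, f i = g i) (hab : a = b) : HasSum g b := by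
  rw [← hab, ← funext hfg]; exact h

namespace TopGraph

variable {V E : Type*} [TopologicalSpace V] [TopologicalSpace E] (G : TopGraph V E)

/-- The fibre sums `v ↦ ∑_{s(e) = v} g(e)` converge and define an element of `C₀(V)`. -/
def HasFiberSum (g : E → ℝ) : Prop :=
  ∃ f : C₀(V, ℝ), ∀ v, HasSum (fun e : {e : E // G.s e = v} => g e) (f v)

variable {G}

theorem lsc_fiberSum [T2Space E] {g : E → ℝ} (hg : Continuous g) (h0 : ∀ e, 0 ≤ g e)
    (hs : ∀ v, Summable (fun e : {e : E // G.s e = v} => g e)) :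
    LowerSemicontinuous (fun v => ∑' e : {e : E // G.s e = v}, g e) := by
  classical
  intro v₀ y hy
  obtain ⟨F, hF⟩ := ((hs v₀).hasSum.eventually (lt_mem_nhds hy)).exists
  have hloc : ∀ e : {e : E // G.s e = v₀}, ∃ σ : V → E, ContinuousAt σ v₀ ∧ σ v₀ = e ∧
      ∀ᶠ v in 𝓝 v₀, G.s (σ v) = v := by
    rintro ⟨e, rfl⟩
    obtain ⟨φ, he, hφ⟩ := G.isLocalHomeomorph_s e
    have ht : G.s e ∈ φ.target := by rw [hφ]; exact φ.map_source he
    refine ⟨φ.symm, φ.symm.continuousAt ht, ?_, ?_⟩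
    · rw [hφ]; exact φ.left_inv he
    · filter_upwards [φ.open_target.mem_nhds ht] with v hv
      rw [hφ]; exact φ.right_inv hv
  choose σ hc h1 h2 using hloc
  have e1 : ∀ᶠ v in 𝓝 v₀, ∀ e ∈ F, G.s (σ e v) = v :=
    (Filter.eventually_all_finset F).2 fun e _ => h2 e
  have e2 : ∀ᶠ v in 𝓝 v₀, ∀ e ∈ F, ∀ e' ∈ F, e ≠ e' → σ e v ≠ σ e' v := by
    refine (Filter.eventually_all_finset F).2 fun e _ =>
      (Filter.eventually_all_finset F).2 fun e' _ => ?_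
    by_cases hee : e = e'
    · exact Filter.Eventually.of_forall fun _ h => absurd hee h
    · have hne : σ e v₀ ≠ σ e' v₀ := by
        rw [h1, h1]; exact fun h => hee (Subtype.ext h)
      filter_upwards [((hc e).tendsto.prodMk_nhds (hc e').tendsto).eventually (isOpen_ne_fun continuous_fst continuous_snd |>.mem_nhds hne)] with v hv _ using hv
  have hcont : ContinuousAt (fun v => ∑ e ∈ F, g (σ e v)) v₀ :=
    tendsto_finsetSum _ fun e _ => (hg.continuousAt.comp (hc e))
  have e3 : ∀ᶠ v in 𝓝 v₀, y < ∑ e ∈ F, g (σ e v) := by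
    refine hcont.eventually (lt_mem_nhds ?_)
    simpa only [h1] using hF
  filter_upwards [e1, e2, e3] with v a1 a2 a3
  refine a3.trans_le ?_
  have hinj : Function.Injective (fun e : F => (⟨σ e v, a1 e e.2⟩ : {e : E // G.s e = v})) := by
    intro e e' h
    by_contra hne
    exact a2 e e.2 e' e'.2 (fun h => hne (Subtype.ext h)) (congrArg Subtype.val h)
  have := Summable.sum_le_tsum (f := fun e : {e : E // G.s e = v} => g e)
    (Finset.univ.map ⟨_, hinj⟩) (fun e _ => h0 e) (hs v)
  rw [Finset.sum_map] at this
  simpa [Finset.sum_attach F (fun e => g (σ e v))] using this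

theorem HasFiberSum.mono [T2Space E] {g h : E → ℝ} (hh : G.HasFiberSum h) (hgc : Continuous g)
    (hhc : Continuous h) (h0 : ∀ e, 0 ≤ g e) (hle : ∀ e, g e ≤ h e) : G.HasFiberSum g := by
  obtain ⟨f, hf⟩ := hh
  have sg : ∀ v, Summable (fun e : {e : E // G.s e = v} => g e) := fun v =>
    Summable.of_nonneg_of_le (fun e => h0 e) (fun e => hle e) (hf v).summable
  have sd : ∀ v, Summable (fun e : {e : E // G.s e = v} => h e - g e) := fun v =>
    (hf v).summable.sub (sg v)
  have l1 : LowerSemicontinuous fun v => ∑' e : {e : E // G.s e = v}, g e :=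
    lsc_fiberSum hgc h0 sg
  have l2 : LowerSemicontinuous fun v => ∑' e : {e : E // G.s e = v}, (h e - g e) :=
    lsc_fiberSum (g := fun e => h e - g e) (hhc.sub hgc) (fun e => sub_nonneg.2 (hle e)) sd
  have hd : ∀ v, ∑' e : {e : E // G.s e = v}, g e
      = f v - ∑' e : {e : E // G.s e = v}, (h e - g e) := by
    intro v
    rw [(hf v).summable.tsum_sub (sg v), (hf v).tsum_eq]; ring
  have u1 : UpperSemicontinuous fun v => ∑' e : {e : E // G.s e = v}, g e := by
    have hfu : UpperSemicontinuous (fun v => f v) := f.continuous.upperSemicontinuous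
    have hnu : UpperSemicontinuous (fun v => -∑' e : {e : E // G.s e = v}, (h e - g e)) := by
      intro v y hy
      have hy' : -y < ∑' e : {e : E // G.s e = v}, (h e - g e) := neg_lt_of_neg_lt hy
      filter_upwards [l2 v (-y) hy'] with w hw
      exact neg_lt_of_neg_lt hw
    have he : (fun v => ∑' e : {e : E // G.s e = v}, g e)
        = fun v => f v + -∑' e : {e : E // G.s e = v}, (h e - g e) :=
      funext fun v => by rw [hd v, sub_eq_add_neg]
    rw [he]
    exact hfu.add hnu
  have hcont : Continuous (fun v => ∑' e : {e : E // G.s e = v}, g e) :=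
    continuous_iff_lower_upperSemicontinuous.2 ⟨l1, u1⟩
  have hlim : Tendsto (fun v => ∑' e : {e : E // G.s e = v}, g e) (cocompact V) (𝓝 0) :=
    squeeze_zero (fun v => (sg v).hasSum.nonneg fun e : {e : E // G.s e = v} => h0 e.1)
      (fun v => hasSum_le (fun e : {e : E // G.s e = v} => hle e.1) (sg v).hasSum (hf v))
      f.zero_at_infty'
  exact ⟨{ toFun := fun v => ∑' e : {e : E // G.s e = v}, g e
           continuous_toFun := hcont
           zero_at_infty' := hlim }, fun v => (sg v).hasSum⟩

theorem HasFiberSum.add {g h : E → ℝ} (hg : G.HasFiberSum g) (hh : G.HasFiberSum h) :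
    G.HasFiberSum (fun e => g e + h e) := by
  obtain ⟨a, ha⟩ := hg
  obtain ⟨b, hb⟩ := hh
  exact ⟨a + b, fun v => (ha v).add (hb v)⟩

theorem HasFiberSum.const_mul {g : E → ℝ} (hg : G.HasFiberSum g) (c : ℝ) :
    G.HasFiberSum (fun e => c * g e) := by
  obtain ⟨a, ha⟩ := hg
  exact ⟨c • a, fun v => (ha v).mul_left c⟩

variable (G)

/-- The continuous functions `ξ` on the edge space for which `v ↦ ∑_{s(e) = v} |ξ(e)|²`
is a (well defined) element of `C₀(V)`. -/
def corrSubmodule [T2Space E] : Submodule ℂ (E → ℂ) where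
  carrier := {ξ | Continuous ξ ∧ G.HasFiberSum fun e => ‖ξ e‖ ^ 2}
  zero_mem' := ⟨continuous_const, 0, fun v => by simp⟩
  add_mem' := by
    rintro ξ η ⟨cξ, hξ⟩ ⟨cη, hη⟩
    refine ⟨cξ.add cη, ((hξ.add hη).const_mul 2).mono ((cξ.add cη).norm.pow 2)
      (by fun_prop) (fun e => by positivity) ?_⟩
    intro e
    have h1 : ‖ξ e + η e‖ ≤ ‖ξ e‖ + ‖η e‖ := norm_add_le _ _
    have h2 := pow_le_pow_left₀ (norm_nonneg _) h1 2
    simp only [Pi.add_apply]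
    nlinarith [sq_nonneg (‖ξ e‖ - ‖η e‖)]
  smul_mem' := by
    rintro c ξ ⟨cξ, hξ⟩
    refine ⟨cξ.const_smul c, ?_⟩
    have := hξ.const_mul (‖c‖ ^ 2)
    simpa [mul_pow] using this

/-- The graph correspondence `X_G` of a topological graph. It is complete for the norm
`‖⟨ξ, ξ⟩‖^(1/2)` and contains `C_c(E)` as a dense subspace. -/
def Corr [T2Space E] : Type _ := G.corrSubmodule

namespace Corr

variable {G} [T2Space E]

noncomputable instance : AddCommGroup G.Corr := inferInstanceAs (AddCommGroup G.corrSubmodule)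
noncomputable instance : Module ℂ G.Corr := inferInstanceAs (Module ℂ G.corrSubmodule)

instance : FunLike G.Corr E ℂ where
  coe ξ := (show G.corrSubmodule from ξ).1
  coe_injective := Subtype.val_injective

@[ext] theorem ext {ξ η : G.Corr} (h : ∀ e, ξ e = η e) : ξ = η :=
  DFunLike.ext _ _ h

@[fun_prop] theorem continuous_coe (ξ : G.Corr) : Continuous ξ := ξ.2.1
@[simp] theorem zero_apply (e : E) : (0 : G.Corr) e = 0 := rfl
@[simp] theorem add_apply (ξ η : G.Corr) (e : E) : (ξ + η) e = ξ e + η e := rfl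
@[simp] theorem smul_apply (c : ℂ) (ξ : G.Corr) (e : E) : (c • ξ) e = c * ξ e := rfl

theorem hasFiberSum (ξ : G.Corr) : G.HasFiberSum fun e => ‖ξ e‖ ^ 2 := ξ.2.2

/-- Build an element of the correspondence. -/
def mk (f : E → ℂ) (hf : Continuous f) (h : G.HasFiberSum fun e => ‖f e‖ ^ 2) : G.Corr :=
  ⟨f, hf, h⟩

@[simp] theorem mk_apply (f : E → ℂ) (hf) (h) (e : E) : (mk (G := G) f hf h) e = f e := rfl

theorem exists_inner (ξ η : G.Corr) : ∃ f : C₀(V, ℂ), ∀ v,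
    HasSum (fun e : {e : E // G.s e = v} => conj (ξ e) * η e) (f v) := by
  obtain ⟨a, ha⟩ := ξ.hasFiberSum
  obtain ⟨b, hb⟩ := η.hasFiberSum
  obtain ⟨c, hc⟩ := (ξ + η).hasFiberSum
  obtain ⟨d, hd⟩ := (ξ + Complex.I • η).hasFiberSum
  have key : ∀ z w : ℂ, conj z * w = ((2⁻¹ * (‖z + w‖ ^ 2 - ‖z‖ ^ 2 - ‖w‖ ^ 2) : ℝ) : ℂ)
      - ((2⁻¹ * (‖z + Complex.I * w‖ ^ 2 - ‖z‖ ^ 2 - ‖w‖ ^ 2) : ℝ) : ℂ) * Complex.I := by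
    intro z w
    simp only [← Complex.normSq_eq_norm_sq]
    apply Complex.ext <;> simp [Complex.normSq_apply] <;> ring
  refine ⟨⟨⟨fun v => ((2⁻¹ * (c v - a v - b v) : ℝ) : ℂ)
      - ((2⁻¹ * (d v - a v - b v) : ℝ) : ℂ) * Complex.I, by fun_prop⟩, ?_⟩, fun v => ?_⟩
  · have h1 := ((c.zero_at_infty'.sub a.zero_at_infty').sub b.zero_at_infty').const_mul (2⁻¹ : ℝ)
    have h2 := ((d.zero_at_infty'.sub a.zero_at_infty').sub b.zero_at_infty').const_mul (2⁻¹ : ℝ)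
    have h3 := (Complex.continuous_ofReal.tendsto _).comp h1
    have h4 := ((Complex.continuous_ofReal.tendsto _).comp h2).mul_const Complex.I
    simpa using h3.sub h4
  · have h1 := Complex.ofRealCLM.hasSum ((((hc v).sub (ha v)).sub (hb v)).mul_left (2⁻¹ : ℝ))
    have h2 := (Complex.ofRealCLM.hasSum
      ((((hd v).sub (ha v)).sub (hb v)).mul_left (2⁻¹ : ℝ))).mul_right Complex.I
    exact hasSum_of_eq (h1.sub h2) (fun e => (key _ _).symm) rfl

/-- The inner product `⟨ξ, η⟩(v) = ∑_{s(e) = v} conj (ξ(e)) η(e)`. -/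
noncomputable def ip (ξ η : G.Corr) : C₀(V, ℂ) where
  toFun v := ∑' e : {e : E // G.s e = v}, conj (ξ e) * η e
  continuous_toFun := by
    obtain ⟨f, hf⟩ := exists_inner ξ η
    exact f.continuous.congr fun v => (hf v).tsum_eq.symm
  zero_at_infty' := by
    obtain ⟨f, hf⟩ := exists_inner ξ η
    exact f.zero_at_infty'.congr fun v => (hf v).tsum_eq.symm

theorem ip_apply (ξ η : G.Corr) (v : V) :
    ip ξ η v = ∑' e : {e : E // G.s e = v}, conj (ξ e) * η e := rfl

theorem hasSum_ip (ξ η : G.Corr) (v : V) :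
    HasSum (fun e : {e : E // G.s e = v} => conj (ξ e) * η e) (ip ξ η v) := by
  obtain ⟨f, hf⟩ := exists_inner ξ η
  exact (hf v).summable.hasSum

theorem hasSum_ip_self (ξ : G.Corr) (v : V) :
    HasSum (fun e : {e : E // G.s e = v} => ‖ξ e‖ ^ 2) (ip ξ ξ v).re := by
  refine hasSum_of_eq (Complex.reCLM.hasSum (hasSum_ip ξ ξ v)) (fun e => ?_) rfl
  rw [Complex.reCLM_apply, Complex.conj_mul', ← Complex.ofReal_pow, Complex.ofReal_re]

theorem ip_self_eq_ofReal (ξ : G.Corr) (v : V) : ip ξ ξ v = ((ip ξ ξ v).re : ℂ) := by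
  refine (hasSum_ip ξ ξ v).unique ?_
  refine hasSum_of_eq (Complex.ofRealCLM.hasSum (hasSum_ip_self ξ v)) (fun e => ?_) rfl
  simp [Complex.conj_mul']

/-- The right action `(ξ · a)(e) = ξ(e) a(s(e))`. -/
noncomputable instance : SMul C₀(V, ℂ) G.Corr where
  smul a ξ := mk (fun e => ξ e * a (G.s e))
    (ξ.continuous_coe.mul (a.continuous.comp G.isLocalHomeomorph_s.continuous)) (by
      obtain ⟨f, hf⟩ := ξ.hasFiberSum
      let b : C₀(V, ℝ) := ⟨⟨fun v => ‖a v‖ ^ 2, by fun_prop⟩, by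
        simpa using (a.zero_at_infty'.norm.pow 2)⟩
      refine ⟨f * b, fun v => ?_⟩
      refine hasSum_of_eq ((hf v).mul_right (‖a v‖ ^ 2)) (fun e => ?_) rfl
      change ‖ξ e‖ ^ 2 * ‖a v‖ ^ 2 = ‖ξ e * a (G.s e)‖ ^ 2
      rw [norm_mul, mul_pow, e.2])

@[simp] theorem right_smul_apply (a : C₀(V, ℂ)) (ξ : G.Corr) (e : E) :
    (a • ξ) e = ξ e * a (G.s e) := rfl

noncomputable instance : Norm G.Corr := ⟨fun ξ => √‖ip ξ ξ‖⟩

/-- `X_G` is a Hilbert module over `C₀(V)`; the scalar multiplication by `C₀(V)` is the right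
action. -/
noncomputable instance : CStarModule C₀(V, ℂ) G.Corr where
  inner := ip
  inner_add_right {ξ η ζ} := by
    ext v
    refine (hasSum_ip ξ (η + ζ) v).unique ?_
    refine hasSum_of_eq ((hasSum_ip ξ η v).add (hasSum_ip ξ ζ v)) (fun e => ?_) rfl
    rw [add_apply, mul_add]
  inner_self_nonneg {ξ} := by
    intro v
    change (0 : ℂ) ≤ ip ξ ξ v
    rw [ip_self_eq_ofReal]
    exact Complex.zero_le_real.2 ((hasSum_ip_self ξ v).nonneg fun e => by positivity)
  inner_self {ξ} := by
    constructor
    · intro h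
      ext e
      have h1 := hasSum_ip_self ξ (G.s e)
      rw [h] at h1
      have h2 := (hasSum_zero_iff_of_nonneg (fun e => by positivity)).1 h1
      have h3 := congrFun h2 ⟨e, rfl⟩
      simpa using h3
    · rintro rfl
      ext v
      simp [ip_apply]
  inner_op_smul_right {a ξ η} := by
    ext v
    refine (hasSum_ip ξ (a • η) v).unique ?_
    refine hasSum_of_eq ((hasSum_ip ξ η v).mul_left (a v)) (fun e => ?_) rfl
    rw [right_smul_apply, e.2]; ring
  inner_smul_right_complex {c ξ η} := by
    ext v
    refine (hasSum_ip ξ (c • η) v).unique ?_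
    refine hasSum_of_eq ((hasSum_ip ξ η v).mul_left c) (fun e => ?_) rfl
    rw [smul_apply]; ring
  star_inner ξ η := by
    ext v
    refine HasSum.unique ?_ (hasSum_ip η ξ v)
    refine hasSum_of_eq (hasSum_ip ξ η v).star (fun e => ?_) rfl
    simp [mul_comm]
  norm_eq_sqrt_norm_inner_self ξ := rfl

noncomputable instance : NormedAddCommGroup G.Corr :=
  CStarModule.normedAddCommGroup C₀(V, ℂ)

noncomputable instance : NormedSpace ℂ G.Corr :=
  NormedSpace.ofCore (CStarModule.normedSpaceCore C₀(V, ℂ))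

theorem norm_def (ξ : G.Corr) : ‖ξ‖ = √‖inner C₀(V, ℂ) ξ ξ‖ := rfl

theorem norm_smul_le_right (a : C₀(V, ℂ)) (ξ : G.Corr) : ‖a • ξ‖ ≤ ‖a‖ * ‖ξ‖ := by
  rw [norm_def, norm_def, CStarModule.inner_op_smul_right, CStarModule.inner_op_smul_left,
    Real.sqrt_le_left (by positivity), mul_pow, Real.sq_sqrt (norm_nonneg _)]
  calc _ ≤ ‖a‖ * (‖inner C₀(V, ℂ) ξ ξ‖ * ‖star a‖) :=
        (norm_mul_le _ _).trans (by gcongr; exact norm_mul_le _ _)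
    _ = _ := by
        have : ‖star a‖ = ‖a‖ := norm_star a
        rw [this]; ring

theorem norm_le_of_le {ξ η : G.Corr} {c : ℝ} (hc : 0 ≤ c) (h : ∀ e, ‖ξ e‖ ≤ c * ‖η e‖) :
    ‖ξ‖ ≤ c * ‖η‖ := by
  rw [norm_def, norm_def, Real.sqrt_le_left (by positivity), mul_pow, Real.sq_sqrt (norm_nonneg _),
    ← ZeroAtInftyContinuousMap.norm_toBCF_eq_norm]
  refine (BoundedContinuousFunction.norm_le (by positivity)).2 fun v => ?_
  change ‖ip ξ ξ v‖ ≤ c ^ 2 * ‖ip η η‖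
  have h1 : (ip ξ ξ v).re ≤ c ^ 2 * (ip η η v).re := by
    refine hasSum_le (fun e => ?_) (hasSum_ip_self ξ v) ((hasSum_ip_self η v).mul_left (c ^ 2))
    rw [← mul_pow]
    exact pow_le_pow_left₀ (norm_nonneg _) (h e) 2
  have h2 : 0 ≤ (ip ξ ξ v).re := (hasSum_ip_self ξ v).nonneg fun e => by positivity
  rw [ip_self_eq_ofReal, Complex.norm_real, Real.norm_of_nonneg h2]
  refine h1.trans ?_
  gcongr
  exact (Complex.re_le_norm _).trans ((ip η η).toBCF.norm_coe_le_norm v)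

/-- The rank one operator `Θ_{ξ,η}(ζ) = ξ · ⟨η, ζ⟩`. -/
noncomputable def rankOne (ξ η : G.Corr) : G.Corr →L[ℂ] G.Corr :=
  LinearMap.mkContinuous
    { toFun := fun ζ => inner C₀(V, ℂ) η ζ • ξ
      map_add' := fun ζ ζ' => by
        ext e
        simp [mul_add]
      map_smul' := fun c ζ => by
        ext e
        simp
        ring }
    (‖ξ‖ * ‖η‖) (fun ζ => by
      refine (norm_smul_le_right _ _).trans ?_
      have := CStarModule.norm_inner_le (A := C₀(V, ℂ)) G.Corr (x := η) (y := ζ)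
      calc _ ≤ (‖η‖ * ‖ζ‖) * ‖ξ‖ := by gcongr
        _ = _ := by ring)

/-- The left action `(φ(a) ξ)(e) = a(r(e)) ξ(e)`. -/
noncomputable def leftAct (a : C₀(V, ℂ)) : G.Corr →L[ℂ] G.Corr :=
  LinearMap.mkContinuous
    { toFun := fun ξ => mk (fun e => a (G.r e) * ξ e)
        ((a.continuous.comp G.continuous_r).mul ξ.continuous_coe) (by
          refine (ξ.hasFiberSum.const_mul (‖a‖ ^ 2)).mono ?_ (by fun_prop)
            (fun e => by positivity) fun e => ?_
          · exact (((a.continuous.comp G.continuous_r).mul ξ.continuous_coe).norm.pow 2)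
          · rw [norm_mul, mul_pow]
            gcongr
            exact a.toBCF.norm_coe_le_norm _)
      map_add' := fun ζ ζ' => by
        ext e
        simp [mul_add]
      map_smul' := fun c ζ => by
        ext e
        simp
        ring }
    ‖a‖ (fun ξ => by
      refine norm_le_of_le (norm_nonneg a) fun e => ?_
      change ‖a (G.r e) * ξ e‖ ≤ _
      rw [norm_mul]
      gcongr
      exact a.toBCF.norm_coe_le_norm _)

variable (G) in
/-- The generalized compact operators: the operator norm closure of the span of the rank one
operators. -/
noncomputable def compactOps : Submodule ℂ (G.Corr →L[ℂ] G.Corr) :=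
  (Submodule.span ℂ {T | ∃ ξ η : G.Corr, T = rankOne ξ η}).topologicalClosure

theorem rankOne_mem_compactOps (ξ η : G.Corr) : rankOne ξ η ∈ compactOps G :=
  Submodule.le_topologicalClosure _ (Submodule.subset_span ⟨ξ, η, rfl⟩)

end Corr
end TopGraph

/-- A topological `k`-graph with vertex (object) space `V` and path (morphism) space `M`: a small
category with range `r`, source `s`, identities `one` and composition `comp μ ν` (defined when
`s μ = r ν`), and a degree functor `d` with the factorization property. The spaces are locally
compact Hausdorff; this is imposed by type classes where it is used. -/
structure TopologicalKGraph (k : ℕ) (V M : Type*) [TopologicalSpace V] [TopologicalSpace M] where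
  r : M → V
  s : M → V
  one : V → M
  comp : ∀ μ ν : M, s μ = r ν → M
  d : M → Fin k → ℕ
  r_one : ∀ v, r (one v) = v
  s_one : ∀ v, s (one v) = v
  r_comp : ∀ μ ν h, r (comp μ ν h) = r μ
  s_comp : ∀ μ ν h, s (comp μ ν h) = s ν
  one_comp : ∀ μ, comp (one (r μ)) μ (s_one _) = μ
  comp_one : ∀ μ, comp μ (one (s μ)) (r_one _).symm = μ
  assoc : ∀ (l μ ν : M) (h₁ : s l = r μ) (h₂ : s μ = r ν),
    comp (comp l μ h₁) ν ((s_comp _ _ _).trans h₂) = comp l (comp μ ν h₂) (h₁.trans (r_comp _ _ _).symm)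
  d_one : ∀ v, d (one v) = 0
  d_comp : ∀ μ ν h, d (comp μ ν h) = d μ + d ν
  continuous_r : Continuous r
  isLocalHomeomorph_s : IsLocalHomeomorph s
  continuous_one : Continuous one
  continuous_comp : Continuous fun p : {p : M × M // s p.1 = r p.2} => comp p.1.1 p.1.2 p.2
  isOpenMap_comp : IsOpenMap fun p : {p : M × M // s p.1 = r p.2} => comp p.1.1 p.1.2 p.2
  continuous_d : Continuous d
  factorization : ∀ (l : M) (m n : Fin k → ℕ), d l = m + n →
    ∃! p : {p : M × M // s p.1 = r p.2}, d p.1.1 = m ∧ d p.1.2 = n ∧ comp p.1.1 p.1.2 p.2 = l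

namespace TopologicalKGraph

open TopGraph

variable {k : ℕ} {V M : Type*} [TopologicalSpace V] [TopologicalSpace M]
  (Λ : TopologicalKGraph k V M)

/-- The space `Λ^m` of paths of degree `m`. -/
abbrev Path (m : Fin k → ℕ) : Type _ := {μ : M // Λ.d μ = m}

/-- The topological graph `E_m = (Λ^0, Λ^m, r, s)`. -/
def graph (m : Fin k → ℕ) : TopGraph V (Λ.Path m) where
  r μ := Λ.r μ
  s μ := Λ.s μ
  continuous_r := Λ.continuous_r.comp continuous_subtype_val
  isLocalHomeomorph_s := Λ.isLocalHomeomorph_s.comp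
    (IsOpen.isOpenEmbedding_subtypeVal
      ((isOpen_discrete {m}).preimage Λ.continuous_d)).isLocalHomeomorph

section Factorization

variable {m n q : Fin k → ℕ} (h : m + n = q)

theorem exists_fac {m n q : Fin k → ℕ} (h : m + n = q) (μ : Λ.Path q) : ∃ p : {p : M × M // Λ.s p.1 = Λ.r p.2},
    Λ.d p.1.1 = m ∧ Λ.d p.1.2 = n ∧ Λ.comp p.1.1 p.1.2 p.2 = μ :=
  (Λ.factorization μ m n (μ.2.trans h.symm)).exists

/-- The factorization `μ = μ(0,m) μ(m,q)` of a path of degree `q = m + n`. -/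
noncomputable def fac {m n q : Fin k → ℕ} (h : m + n = q) (μ : Λ.Path q) : {p : M × M // Λ.s p.1 = Λ.r p.2} :=
  (Λ.exists_fac h μ).choose

theorem fac_spec (μ : Λ.Path q) : Λ.d (Λ.fac h μ).1.1 = m ∧ Λ.d (Λ.fac h μ).1.2 = n ∧
    Λ.comp (Λ.fac h μ).1.1 (Λ.fac h μ).1.2 (Λ.fac h μ).2 = μ :=
  (Λ.exists_fac h μ).choose_spec

/-- The initial segment `μ(0,m)`. -/
noncomputable def head (μ : Λ.Path q) : Λ.Path m := ⟨(Λ.fac h μ).1.1, (Λ.fac_spec h μ).1⟩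

/-- The final segment `μ(m,q)`. -/
noncomputable def tail (μ : Λ.Path q) : Λ.Path n := ⟨(Λ.fac h μ).1.2, (Λ.fac_spec h μ).2.1⟩

theorem s_head (μ : Λ.Path q) : Λ.s (Λ.head h μ) = Λ.r (Λ.tail h μ) := (Λ.fac h μ).2

theorem comp_head_tail (μ : Λ.Path q) :
    Λ.comp (Λ.head h μ) (Λ.tail h μ) (Λ.s_head h μ) = μ := (Λ.fac_spec h μ).2.2

theorem s_tail (μ : Λ.Path q) : Λ.s (Λ.tail h μ) = Λ.s μ := by
  conv_rhs => rw [← Λ.comp_head_tail h μ]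
  rw [Λ.s_comp]

theorem eq_fac (μ : Λ.Path q) (p : {p : M × M // Λ.s p.1 = Λ.r p.2}) (h₁ : Λ.d p.1.1 = m)
    (h₂ : Λ.d p.1.2 = n) (h₃ : Λ.comp p.1.1 p.1.2 p.2 = μ) : p = Λ.fac h μ :=
  (Λ.factorization μ m n (μ.2.trans h.symm)).unique ⟨h₁, h₂, h₃⟩ (Λ.fac_spec h μ)

theorem head_eq (μ : Λ.Path q) (a : Λ.Path m) (b : Λ.Path n) (hab : Λ.s a = Λ.r b)
    (hc : Λ.comp a b hab = μ) : Λ.head h μ = a :=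
  Subtype.ext (congrArg (fun p => p.1.1) (Λ.eq_fac h μ ⟨(a, b), hab⟩ a.2 b.2 hc)).symm

theorem tail_eq (μ : Λ.Path q) (a : Λ.Path m) (b : Λ.Path n) (hab : Λ.s a = Λ.r b)
    (hc : Λ.comp a b hab = μ) : Λ.tail h μ = b :=
  Subtype.ext (congrArg (fun p => p.1.2) (Λ.eq_fac h μ ⟨(a, b), hab⟩ a.2 b.2 hc)).symm

theorem continuous_fac : Continuous (Λ.fac h) := by
  refine continuous_def.2 fun U hU => ?_
  have h₁ : IsOpen {p : {p : M × M // Λ.s p.1 = Λ.r p.2} | Λ.d p.1.1 = m} :=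
    (isOpen_discrete {m}).preimage (Λ.continuous_d.comp (continuous_fst.comp continuous_subtype_val))
  have h₂ : IsOpen {p : {p : M × M // Λ.s p.1 = Λ.r p.2} | Λ.d p.1.2 = n} :=
    (isOpen_discrete {n}).preimage (Λ.continuous_d.comp (continuous_snd.comp continuous_subtype_val))
  have h₃ := (Λ.isOpenMap_comp _ ((hU.inter h₁).inter h₂)).preimage
    (continuous_subtype_val (p := fun μ => Λ.d μ = q))
  convert h₃ using 1
  ext μ
  constructor
  · intro hμ
    exact ⟨Λ.fac h μ, ⟨⟨hμ, (Λ.fac_spec h μ).1⟩, (Λ.fac_spec h μ).2.1⟩, (Λ.fac_spec h μ).2.2⟩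
  · rintro ⟨p, ⟨⟨h₄, h₅⟩, h₆⟩, h₇⟩
    change Λ.fac h μ ∈ U
    rw [← Λ.eq_fac h μ p h₅ h₆ h₇]
    exact h₄

theorem continuous_head : Continuous (Λ.head h) :=
  (continuous_fst.comp (continuous_subtype_val.comp (Λ.continuous_fac h))).subtype_mk _

theorem continuous_tail : Continuous (Λ.tail h) :=
  (continuous_snd.comp (continuous_subtype_val.comp (Λ.continuous_fac h))).subtype_mk _

/-- Paths of degree `m + n` with source `v` are pairs of composable paths. -/
noncomputable def fiberEquiv (v : V) : {μ : Λ.Path q // Λ.s μ = v} ≃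
    Σ ν : {ν : Λ.Path n // Λ.s ν = v}, {κ : Λ.Path m // Λ.s κ = Λ.r ν.1} where
  toFun μ := ⟨⟨Λ.tail h μ.1, (Λ.s_tail h μ.1).trans μ.2⟩, ⟨Λ.head h μ.1, Λ.s_head h μ.1⟩⟩
  invFun p := ⟨⟨Λ.comp p.2.1 p.1.1 p.2.2, by rw [Λ.d_comp, p.2.1.2, p.1.1.2, h]⟩,
    (Λ.s_comp _ _ _).trans p.1.2⟩
  left_inv μ := Subtype.ext (Subtype.ext (Λ.comp_head_tail h μ.1))
  right_inv := by
    rintro ⟨⟨ν, hν⟩, ⟨κ, hκ⟩⟩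
    have h₁ := Λ.head_eq h ⟨Λ.comp κ ν hκ, by rw [Λ.d_comp, κ.2, ν.2, h]⟩ κ ν hκ rfl
    have h₂ := Λ.tail_eq h ⟨Λ.comp κ ν hκ, by rw [Λ.d_comp, κ.2, ν.2, h]⟩ κ ν hκ rfl
    refine Sigma.ext (Subtype.ext h₂) ?_
    simp only
    refine (Subtype.heq_iff_coe_eq ?_).2 h₁
    intro x
    rw [h₂]

end Factorization

theorem eq_one (μ : Λ.Path 0) : (μ : M) = Λ.one (Λ.r μ) := by
  have h₁ := Λ.head_eq (add_zero 0) μ ⟨Λ.one (Λ.r μ), Λ.d_one _⟩ μ (Λ.s_one _) (Λ.one_comp _)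
  have h₂ := Λ.head_eq (add_zero 0) μ μ ⟨Λ.one (Λ.s μ), Λ.d_one _⟩ (Λ.r_one _).symm (Λ.comp_one _)
  exact congrArg Subtype.val (h₂.symm.trans h₁)

variable [T2Space M]

/-- The fibre `X^Λ_m` of the topological `k`-graph correspondence. -/
abbrev Fib (m : Fin k → ℕ) : Type _ := (Λ.graph m).Corr

/-- The multiplication `X_m × X_n → X_q`, `q = m + n`, of the product system:
`(ξ η)(μ) = ξ(μ(0,m)) η(μ(m,q))`. -/
noncomputable def mul {m n q : Fin k → ℕ} (h : m + n = q) (ξ : Λ.Fib m) (η : Λ.Fib n) : Λ.Fib q :=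
  Corr.mk (fun μ => ξ (Λ.head h μ) * η (Λ.tail h μ))
    ((ξ.continuous_coe.comp (Λ.continuous_head h)).mul
      (η.continuous_coe.comp (Λ.continuous_tail h)))
    (by
      obtain ⟨f, hf⟩ := ξ.hasFiberSum
      have hf0 : ∀ v, 0 ≤ f v := fun v => (hf v).nonneg fun e => by positivity
      have hfc : Continuous fun ν : Λ.Path n => f (Λ.r ν) :=
        f.continuous.comp (Λ.graph n).continuous_r
      obtain ⟨g, hg⟩ : (Λ.graph n).HasFiberSum fun ν => f (Λ.r ν) * ‖η ν‖ ^ 2 := by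
        refine (η.hasFiberSum.const_mul ‖f‖).mono (hfc.mul (η.continuous_coe.norm.pow 2))
          (continuous_const.mul (η.continuous_coe.norm.pow 2))
          (fun e => mul_nonneg (hf0 _) (by positivity)) fun e => ?_
        gcongr
        exact (le_abs_self _).trans (f.toBCF.norm_coe_le_norm _)
      refine ⟨g, fun v => ?_⟩
      have hin : ∀ ν : {ν : Λ.Path n // Λ.s ν = v},
          HasSum (fun κ : {κ : Λ.Path m // Λ.s κ = Λ.r ν.1} =>
            ‖ξ κ‖ ^ 2 * ‖η ν‖ ^ 2) (f (Λ.r ν.1) * ‖η ν‖ ^ 2) := fun ν =>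
        (hf (Λ.r ν.1)).mul_right _
      have hsum : Summable (fun p : Σ ν : {ν : Λ.Path n // Λ.s ν = v},
          {κ : Λ.Path m // Λ.s κ = Λ.r ν.1} => ‖ξ p.2.1‖ ^ 2 * ‖η p.1.1‖ ^ 2) := by
        refine (summable_sigma_of_nonneg fun p => by positivity).2
          ⟨fun ν => (hin ν).summable, ?_⟩
        exact (hg v).summable.congr fun ν => (hin ν).tsum_eq.symm
      have htot := (hg v).unique (hsum.hasSum.sigma hin)
      have hs := (Λ.fiberEquiv h v).hasSum_iff.2 hsum.hasSum
      refine hasSum_of_eq hs (fun μ => ?_) htot.symm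
      change ‖ξ (Λ.head h μ.1)‖ ^ 2 * ‖η (Λ.tail h μ.1)‖ ^ 2
        = ‖ξ (Λ.head h μ.1) * η (Λ.tail h μ.1)‖ ^ 2
      rw [norm_mul, mul_pow])

@[simp] theorem mul_apply {m n q : Fin k → ℕ} (h : m + n = q) (ξ : Λ.Fib m) (η : Λ.Fib n)
    (μ : Λ.Path q) : Λ.mul h ξ η μ = ξ (Λ.head h μ) * η (Λ.tail h μ) := rfl

/-- The identification of `C₀(V)` with the fibre `X^Λ_0`: `a` is viewed as the function `a ∘ r`
on `Λ^0`. -/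
noncomputable def unitFib (a : C₀(V, ℂ)) : Λ.Fib 0 :=
  Corr.mk (fun μ => a (Λ.r μ)) (a.continuous.comp (Λ.graph 0).continuous_r) (by
    let b : C₀(V, ℝ) := ⟨⟨fun v => ‖a v‖ ^ 2, by fun_prop⟩, by
      simpa using (a.zero_at_infty'.norm.pow 2)⟩
    refine ⟨b, fun v => ?_⟩
    let e : {μ : Λ.Path 0 // (Λ.graph 0).s μ = v} := ⟨⟨Λ.one v, Λ.d_one v⟩, Λ.s_one v⟩
    have he : ∀ x : {μ : Λ.Path 0 // (Λ.graph 0).s μ = v}, x = e := by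
      rintro ⟨μ, rfl⟩
      refine Subtype.ext (Subtype.ext ?_)
      have h₁ := Λ.eq_one μ
      have h₂ : Λ.s μ = Λ.r μ := by
        have := congrArg Λ.s h₁
        rwa [Λ.s_one] at this
      change (μ : M) = Λ.one (Λ.s μ)
      rw [h₂]; exact h₁
    have hs := hasSum_single (f := fun μ : {μ : Λ.Path 0 // (Λ.graph 0).s μ = v} =>
      ‖a (Λ.r μ.1)‖ ^ 2) e (fun x hx => absurd (he x) hx)
    refine hasSum_of_eq hs (fun _ => rfl) ?_
    change ‖a (Λ.r (Λ.one v))‖ ^ 2 = ‖a v‖ ^ 2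
    rw [Λ.r_one])

/-- The generalized compact operators `K(X_m)`. -/
noncomputable abbrev compacts (m : Fin k → ℕ) : Submodule ℂ (Λ.Fib m →L[ℂ] Λ.Fib m) :=
  Corr.compactOps (Λ.graph m)

/-- The left action `φ_m : C₀(V) → L(X_m)`. -/
noncomputable abbrev phi (m : Fin k → ℕ) (a : C₀(V, ℂ)) : Λ.Fib m →L[ℂ] Λ.Fib m :=
  Corr.leftAct (G := Λ.graph m) a

open Classical in
/-- `ι_p^q(S)` is the operator on `X_q` characterized by `ι_p^q(S)(ξ η) = S(ξ) η` for `ξ ∈ X_p`,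
`η ∈ X_{q-p}` if `p ≤ q` (it exists for adjointable `S`, and is unique since the products `ξ η`
span a dense subspace); for `p = 0` this is the left action. By convention `ι_p^q(S) = 0` if
`p ≰ q`. -/
noncomputable def iota (p q : Fin k → ℕ) (S : Λ.Fib p →L[ℂ] Λ.Fib p) : Λ.Fib q →L[ℂ] Λ.Fib q :=
  if h : ∃ hpq : p ≤ q, ∃ R : Λ.Fib q →L[ℂ] Λ.Fib q, ∀ (ξ : Λ.Fib p) (η : Λ.Fib (q - p)),
      R (Λ.mul (add_tsub_cancel_of_le hpq) ξ η) = Λ.mul (add_tsub_cancel_of_le hpq) (S ξ) η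
  then h.choose_spec.choose else 0

/-- The product system `X^Λ` is compactly aligned (any two elements of `ℕ^k` have a least
upper bound). -/
def CorrCompactlyAligned : Prop :=
  ∀ p q : Fin k → ℕ, ∀ S ∈ Λ.compacts p, ∀ T ∈ Λ.compacts q,
    (Λ.iota p (p ⊔ q) S).comp (Λ.iota q (p ⊔ q) T) ∈ Λ.compacts (p ⊔ q)

/-- The ideal `I_m = ⋂_{0 < r ≤ m} ker φ_r` of `C₀(V)`; in particular `I_0 = C₀(V)`. -/
def idealI (m : Fin k → ℕ) : Set C₀(V, ℂ) :=
  {a | ∀ r, r ≠ 0 → r ≤ m → Λ.phi r a = 0}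

/-- The closed submodule `X_p · I` of `X_p`. -/
noncomputable def fibMulIdeal (p : Fin k → ℕ) (I : Set C₀(V, ℂ)) : Submodule ℂ (Λ.Fib p) :=
  (Submodule.span ℂ {x | ∃ ξ : Λ.Fib p, ∃ a ∈ I, x = a • ξ}).topologicalClosure

/-- `X̃_q = ⨁_{p ≤ q} X_p · I_{q-p}`, as a subspace of `∏_{p ≤ q} X_p`. -/
noncomputable def tildeFib (q : Fin k → ℕ) : Submodule ℂ (∀ p : Set.Iic q, Λ.Fib p.1) :=
  Submodule.pi Set.univ fun p => Λ.fibMulIdeal p.1 (Λ.idealI (q - p.1))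

/-- The left action on `X̃_q`: `(φ̃_q(a) ξ)(p) = φ_p(a) ξ(p)`. -/
noncomputable def tildePhi (q : Fin k → ℕ) (a : C₀(V, ℂ)) (ξ : Λ.tildeFib q) :
    ∀ p : Set.Iic q, Λ.Fib p.1 :=
  fun p => Λ.phi p.1 a (ξ.1 p)

/-- The operator `ι̃_p^q(S)` on `X̃_q`: `(ι̃_p^q(S) ξ)(r) = ι_p^r(S) ξ(r)`. -/
noncomputable def tildeIota (p q : Fin k → ℕ) (S : Λ.Fib p →L[ℂ] Λ.Fib p) (ξ : Λ.tildeFib q) :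
    ∀ r : Set.Iic q, Λ.Fib r.1 :=
  fun r => Λ.iota p r.1 S (ξ.1 r)

/-- A (Toeplitz) representation of the product system `X^Λ` in a `C*`-algebra `B`. The
homomorphism `base` is `ψ_e` on `C₀(V)`, which is identified with `X_0`; `a • ξ` is the right
action. -/
structure ToeplitzRep (B : Type*) [NonUnitalCStarAlgebra B] where
  base : C₀(V, ℂ) →⋆ₙₐ[ℂ] B
  fib : ∀ m : Fin k → ℕ, Λ.Fib m →ₗ[ℂ] B
  fib_zero : ∀ a, fib 0 (Λ.unitFib a) = base a
  fib_right : ∀ m (ξ : Λ.Fib m) (a : C₀(V, ℂ)), fib m (a • ξ) = fib m ξ * base a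
  fib_inner : ∀ m (ξ η : Λ.Fib m), star (fib m ξ) * fib m η = base (inner C₀(V, ℂ) ξ η)
  fib_left : ∀ m (a : C₀(V, ℂ)) (ξ : Λ.Fib m), fib m (Λ.phi m a ξ) = base a * fib m ξ
  fib_mul : ∀ m n (ξ : Λ.Fib m) (η : Λ.Fib n), fib (m + n) (Λ.mul rfl ξ η) = fib m ξ * fib n η

/-- A property of `s ∈ ℕ^k` holds for large `s`. -/
def ForLarge (P : (Fin k → ℕ) → Prop) : Prop :=
  ∀ q, ∃ r, q ≤ r ∧ ∀ s, r ≤ s → P s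

namespace ToeplitzRep

variable {Λ} {B : Type*} [NonUnitalCStarAlgebra B] (ψ : Λ.ToeplitzRep B)

open Classical in
/-- `ψ^{(m)} : K(X_m) → B`, the continuous linear map (in fact a homomorphism) determined by
`ψ^{(m)}(Θ_{ξ,η}) = ψ_m(ξ) ψ_m(η)*`. -/
noncomputable def onCompacts (m : Fin k → ℕ) : Λ.compacts m →L[ℂ] B :=
  if h : ∃ f : Λ.compacts m →L[ℂ] B, ∀ ξ η : Λ.Fib m,
      f ⟨Corr.rankOne ξ η, Corr.rankOne_mem_compactOps ξ η⟩ = ψ.fib m ξ * star (ψ.fib m η)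
  then h.choose else 0

/-- Cuntz–Pimsner covariance in Katsura's sense: `ψ^{(m)}(φ_m(a)) = ψ_e(a)` for every `m` and
every `a ∈ φ_m⁻¹(K(X_m)) ∩ (ker φ_m)^⊥`. -/
def IsCuntzPimsnerCovariant : Prop :=
  ∀ (m : Fin k → ℕ) (a : C₀(V, ℂ)) (ha : Λ.phi m a ∈ Λ.compacts m),
    (∀ b, Λ.phi m b = 0 → a * b = 0) → ψ.onCompacts m ⟨Λ.phi m a, ha⟩ = ψ.base a

/-- Nica covariance. -/
def IsNicaCovariant : Prop :=
  ∀ (p q : Fin k → ℕ) (S : Λ.compacts p) (T : Λ.compacts q),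
    ∃ h : (Λ.iota p (p ⊔ q) S).comp (Λ.iota q (p ⊔ q) T) ∈ Λ.compacts (p ⊔ q),
      ψ.onCompacts p S * ψ.onCompacts q T = ψ.onCompacts (p ⊔ q) ⟨_, h⟩

/-- Cuntz–Pimsner covariance in the sense of Sims and Yeend. -/
def IsSimsYeendCovariant : Prop :=
  ∀ (F : Finset (Fin k → ℕ)) (T : ∀ p, Λ.compacts p),
    ForLarge (fun s => ∀ ξ : Λ.tildeFib s, ∑ p ∈ F, Λ.tildeIota p s (T p) ξ = 0) →
      ∑ p ∈ F, ψ.onCompacts p (T p) = 0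

/-- Cuntz–Nica–Pimsner covariance. -/
def IsCNPCovariant : Prop :=
  ψ.IsSimsYeendCovariant ∧ ψ.IsNicaCovariant

end ToeplitzRep

end TopologicalKGraph

/-- A topological dynamical system: pairwise commuting local homeomorphisms `T_1, …, T_k`
of `Ω`. -/
structure TopDynSystem (k : ℕ) (Ω : Type*) [TopologicalSpace Ω] where
  T : Fin k → Ω → Ω
  isLocalHomeomorph : ∀ i, IsLocalHomeomorph (T i)
  comm : ∀ i j x, T i (T j x) = T j (T i x)

namespace TopDynSystem

variable {k : ℕ} {Ω : Type*} [TopologicalSpace Ω] (D : TopDynSystem k Ω)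

/-- `Θ_m = T_1^{m_1} ⋯ T_k^{m_k}`. -/
def theta (m : Fin k → ℕ) (x : Ω) : Ω :=
  (List.finRange k).foldr (fun i y => (D.T i)^[m i] y) x

theorem theta_zero (x : Ω) : D.theta 0 x = x := by
  unfold theta
  induction List.finRange k with
  | nil => rfl
  | cons i l ih => simp

theorem theta_add (m n : Fin k → ℕ) (x : Ω) : D.theta (m + n) x = D.theta n (D.theta m x) := by
  have hc : ∀ i j (a b : ℕ), Function.Commute (D.T i)^[a] (D.T j)^[b] := fun i j a b =>
    Function.Commute.iterate_iterate (fun x => D.comm i j x) a b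
  have hl : ∀ (l : List (Fin k)) (i : Fin k) (a : ℕ) (x : Ω),
      l.foldr (fun i y => (D.T i)^[n i] y) ((D.T i)^[a] x)
        = (D.T i)^[a] (l.foldr (fun i y => (D.T i)^[n i] y) x) := by
    intro l i a x
    induction l with
    | nil => rfl
    | cons j l ih =>
      simp only [List.foldr_cons]
      rw [ih]
      exact hc j i _ _ _
  unfold theta
  induction List.finRange k with
  | nil => rfl
  | cons i l ih =>
    simp only [List.foldr_cons]
    rw [ih, hl, Pi.add_apply, add_comm (m i), Function.iterate_add_apply]

theorem isLocalHomeomorph_theta (m : Fin k → ℕ) : IsLocalHomeomorph (D.theta m) := by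
  have hi : ∀ i (a : ℕ), IsLocalHomeomorph (D.T i)^[a] := by
    intro i a
    induction a with
    | zero => exact (Homeomorph.refl Ω).isLocalHomeomorph
    | succ a ih => exact ih.comp (D.isLocalHomeomorph i)
  unfold theta
  induction List.finRange k with
  | nil => exact (Homeomorph.refl Ω).isLocalHomeomorph
  | cons i l ih => exact (hi i (m i)).comp ih

theorem continuous_theta : Continuous fun p : (Fin k → ℕ) × Ω => D.theta p.1 p.2 :=
  continuous_prod_of_discrete_left.2 fun m => (D.isLocalHomeomorph_theta m).continuous

/-- The topological `k`-graph of the system: the paths are the pairs `(n, x)`, with `r(n,x) = x`,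
`s(n,x) = Θ_n(x)`, `d(n,x) = n` and `(n,x) ∘ (m,Θ_n(x)) = (n+m,x)`. -/
def kGraph : TopologicalKGraph k Ω ((Fin k → ℕ) × Ω) where
  r p := p.2
  s p := D.theta p.1 p.2
  one x := (0, x)
  comp p q _ := (p.1 + q.1, p.2)
  d p := p.1
  r_one _ := rfl
  s_one := D.theta_zero
  r_comp _ _ _ := rfl
  s_comp p q h := by
    change D.theta (p.1 + q.1) p.2 = _
    rw [D.theta_add, h]
  one_comp p := by simp
  comp_one p := by simp
  assoc p q t _ _ := by simp [add_assoc]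
  d_one _ := rfl
  d_comp _ _ _ := rfl
  continuous_r := continuous_snd
  isLocalHomeomorph_s := by
    have h : ∀ n : Fin k → ℕ, IsLocalHomeomorph (fun x : Ω => (n, x)) := fun n => by
      refine (Topology.IsOpenEmbedding.of_continuous_injective_isOpenMap (by fun_prop)
        (fun x y h => (Prod.ext_iff.1 h).2) fun U hU => ?_).isLocalHomeomorph
      have : (fun x : Ω => (n, x)) '' U = {n} ×ˢ U := by ext ⟨a, b⟩; simp [eq_comm, and_comm]
      rw [this]
      exact (isOpen_discrete _).prod hU
    refine isLocalHomeomorph_iff_isLocalHomeomorphOn_univ.2 fun p _ => ?_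
    have h₁ : IsLocalHomeomorphOn
        ((fun p : (Fin k → ℕ) × Ω => D.theta p.1 p.2) ∘ (fun x : Ω => (p.1, x))) Set.univ :=
      isLocalHomeomorph_iff_isLocalHomeomorphOn_univ.1 (D.isLocalHomeomorph_theta p.1)
    exact h₁.of_comp_right (isLocalHomeomorph_iff_isLocalHomeomorphOn_univ.1 (h p.1)) p
      ⟨p.2, trivial, rfl⟩
  continuous_one := by fun_prop
  continuous_comp := by fun_prop
  isOpenMap_comp := by
    let e : {p : ((Fin k → ℕ) × Ω) × ((Fin k → ℕ) × Ω) // D.theta p.1.1 p.1.2 = p.2.2} ≃ₜ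
        ((Fin k → ℕ) × (Fin k → ℕ)) × Ω :=
      { toFun := fun p => ((p.1.1.1, p.1.2.1), p.1.1.2)
        invFun := fun p => ⟨((p.1.1, p.2), (p.1.2, D.theta p.1.1 p.2)), rfl⟩
        left_inv := by
          rintro ⟨⟨⟨a, b⟩, ⟨c, d⟩⟩, h⟩
          simp only at h
          subst h
          rfl
        right_inv := fun _ => rfl
        continuous_toFun := by fun_prop
        continuous_invFun := by
          have : Continuous fun p : ((Fin k → ℕ) × (Fin k → ℕ)) × Ω => D.theta p.1.1 p.2 :=
            D.continuous_theta.comp (by fun_prop : Continuous fun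
              p : ((Fin k → ℕ) × (Fin k → ℕ)) × Ω => (p.1.1, p.2))
          exact Continuous.subtype_mk (by fun_prop) _ }
    have h₁ : IsOpenMap (fun a : (Fin k → ℕ) × (Fin k → ℕ) => a.1 + a.2) :=
      fun _ _ => isOpen_discrete _
    exact (h₁.prodMap (IsOpenMap.id (X := Ω))).comp e.isOpenMap
  continuous_d := continuous_fst
  factorization := by
    rintro ⟨l, x⟩ m n h
    simp only at h
    subst h
    refine ⟨⟨((m, x), (n, D.theta m x)), rfl⟩, ⟨rfl, rfl, rfl⟩, ?_⟩
    rintro ⟨⟨⟨a, b⟩, ⟨c, d⟩⟩, h⟩ ⟨h₁, h₂, h₃⟩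
    simp only at h h₁ h₂
    obtain ⟨-, h₄⟩ := Prod.ext_iff.1 h₃
    simp only at h₄
    subst h₁ h₂ h₄ h
    rfl

end TopDynSystem

/-! In the `k`-graph of a dynamical system a path is determined by its degree and its range, and
every point of `Ω` is the range of a path of each degree. So `X_m` consists of functions on `Ω` on
which `C₀(Ω)` acts from the left by multiplication. This action is faithful (`phi_injective`) and by
generalized compacts (`phi_mem_compacts`): if `a` is supported where `Θ_m` is injective and `b` is a
bump equal to `1` on that support, then `φ_m(a)` is the rank one operator of `a ∘ r` and `b ∘ r`,
and such `a` span a dense subspace.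

Faithfulness has two effects. The condition `a ∈ (ker φ_m)^⊥` in (CP-K) is void. Moreover `I_m = 0`
for `m ≠ 0`, so `X̃_q` is `X_q` placed at the component `q`, and `φ̃_q` is injective.

Compactness gives `ι_p^q(Θ_{ξ·a,η}) = Θ_{ξζ,ηω}` whenever `φ_{q-p}(a) = Θ_{ζ,ω}` (`iota_rankOne`),
so `ι_p^q` maps compacts to compacts and the system is compactly aligned. Under (CP-K) the same
formula yields `ψ^{(q)} ∘ ι_p^q = ψ^{(p)}` (`onCompacts_iota`). Both parts of CNP-covariance follow
by moving all operators to one common fibre, `X_{p∨q}` for (N) and a large `X_s` for (CP-SY), and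
applying the homomorphism `ψ^{(p∨q)}` or `ψ^{(s)}` there. Conversely, `ι_0^s(φ_0(a)) = φ_s(a) =
ι_m^s(φ_m(a))` for `s ≥ m`, so (CP-SY) for the pair `φ_0(a)`, `-φ_m(a)` is exactly (CP-K).

Since `iota` and `onCompacts` are defined by choice with default value `0`, the objects they stand
for must be shown to exist. For `ι` this is `exists_tensor_one`, which rests on `re_ip_apply_le`, on
density of products (`productsDense`) and on completeness of `X_q`. For `ψ^{(m)}` it is the estimate
`norm_sum_fib_mul_star_le`. -/

namespace TopGraph
namespace Corr

variable {V E : Type*} [TopologicalSpace V] [TopologicalSpace E] {G : TopGraph V E} [T2Space E]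

/-! ### Hilbert module calculus in the correspondence of a topological graph. -/

theorem ip_smul_right (a : C₀(V, ℂ)) (ξ η : G.Corr) : ip ξ (a • η) = a * ip ξ η :=
  CStarModule.inner_op_smul_right (A := C₀(V, ℂ)) (E := G.Corr)

theorem star_ip (ξ η : G.Corr) : star (ip ξ η) = ip η ξ :=
  CStarModule.star_inner (A := C₀(V, ℂ)) ξ η

theorem ip_smul_left (a : C₀(V, ℂ)) (ξ η : G.Corr) : ip (a • ξ) η = ip ξ η * star a :=
  CStarModule.inner_op_smul_left (A := C₀(V, ℂ)) (E := G.Corr)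

theorem norm_sq_eq (ξ : G.Corr) : ‖ξ‖ ^ 2 = ‖ip ξ ξ‖ := by
  rw [norm_def, Real.sq_sqrt (norm_nonneg _)]
  rfl

theorem re_ip_self_nonneg (ξ : G.Corr) (v : V) : 0 ≤ (ip ξ ξ v).re :=
  (hasSum_ip_self ξ v).nonneg fun _ => by positivity

theorem norm_ip_self_apply (ξ : G.Corr) (v : V) : ‖ip ξ ξ v‖ = (ip ξ ξ v).re := by
  rw [ip_self_eq_ofReal, Complex.norm_real, Real.norm_of_nonneg (re_ip_self_nonneg ξ v),
    Complex.ofReal_re]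

theorem re_ip_self_le (ξ : G.Corr) (v : V) : (ip ξ ξ v).re ≤ ‖ξ‖ ^ 2 := by
  rw [norm_sq_eq]
  exact (Complex.re_le_norm _).trans ((ip ξ ξ).toBCF.norm_coe_le_norm v)

theorem norm_le_of_re_ip_self_le {ξ : G.Corr} {c : ℝ} (hc : 0 ≤ c)
    (h : ∀ v, (ip ξ ξ v).re ≤ c ^ 2) : ‖ξ‖ ≤ c := by
  refine (sq_le_sq₀ (norm_nonneg _) hc).1 ?_
  rw [norm_sq_eq, ← ZeroAtInftyContinuousMap.norm_toBCF_eq_norm]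
  refine (BoundedContinuousFunction.norm_le (by positivity)).2 fun v => ?_
  exact (norm_ip_self_apply ξ v).trans_le (h v)

theorem norm_apply_le (ξ : G.Corr) (e : E) : ‖ξ e‖ ≤ ‖ξ‖ := by
  refine (sq_le_sq₀ (norm_nonneg _) (norm_nonneg _)).1 ((re_ip_self_le ξ (G.s e)).trans' ?_)
  exact le_hasSum (hasSum_ip_self ξ (G.s e)) ⟨e, rfl⟩ fun _ _ => by positivity

@[simp] theorem sub_apply (ξ η : G.Corr) (e : E) : (ξ - η) e = ξ e - η e := rfl

theorem sum_apply {ι : Type*} (s : Finset ι) (f : ι → G.Corr) (e : E) :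
    (∑ i ∈ s, f i) e = ∑ i ∈ s, f i e :=
  map_sum (⟨⟨fun ξ : G.Corr => ξ e, rfl⟩, fun _ _ => rfl⟩ : G.Corr →+ ℂ) f s

@[simp] theorem leftAct_apply (a : C₀(V, ℂ)) (ξ : G.Corr) (e : E) :
    leftAct a ξ e = a (G.r e) * ξ e := rfl

theorem rankOne_apply (ξ η ζ : G.Corr) : rankOne ξ η ζ = ip η ζ • ξ := rfl

@[simp] theorem rankOne_apply_apply (ξ η ζ : G.Corr) (e : E) :
    rankOne ξ η ζ e = ξ e * ip η ζ (G.s e) := rfl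

theorem norm_leftAct_le (a : C₀(V, ℂ)) : ‖(leftAct a : G.Corr →L[ℂ] G.Corr)‖ ≤ ‖a‖ :=
  LinearMap.mkContinuous_norm_le _ (norm_nonneg _) _

theorem norm_rankOne_le (ξ η : G.Corr) : ‖rankOne ξ η‖ ≤ ‖ξ‖ * ‖η‖ :=
  LinearMap.mkContinuous_norm_le _ (by positivity) _

variable (G) in
/-- The left action as a continuous linear map. -/
noncomputable def leftActL : C₀(V, ℂ) →L[ℂ] G.Corr →L[ℂ] G.Corr :=
  LinearMap.mkContinuous
    { toFun := fun a => leftAct a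
      map_add' := fun a b => by ext ξ e; simp [add_mul]
      map_smul' := fun c a => by ext ξ e; simp [mul_assoc] } 1
    fun a => by simpa using norm_leftAct_le (G := G) a

@[simp] theorem leftActL_apply (a : C₀(V, ℂ)) : leftActL G a = leftAct a := rfl

/-- The map `a ↦ ξ · a` as a continuous linear map. -/
noncomputable def rightActL (ξ : G.Corr) : C₀(V, ℂ) →L[ℂ] G.Corr :=
  LinearMap.mkContinuous
    { toFun := fun a => a • ξ
      map_add' := fun a b => by ext e; simp [mul_add]
      map_smul' := fun c a => by ext e; simp; ring } ‖ξ‖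
    fun a => (norm_smul_le_right a ξ).trans_eq (mul_comm _ _)

@[simp] theorem rightActL_apply (ξ : G.Corr) (a : C₀(V, ℂ)) : rightActL ξ a = a • ξ := rfl

/-- The map `ξ ↦ Θ_{ξ,η}` as a continuous linear map. -/
noncomputable def rankOneL (η : G.Corr) : G.Corr →L[ℂ] G.Corr →L[ℂ] G.Corr :=
  LinearMap.mkContinuous
    { toFun := fun ξ => rankOne ξ η
      map_add' := fun a b => by ext ζ e; simp [add_mul]
      map_smul' := fun c a => by ext ζ e; simp [mul_assoc] } ‖η‖
    fun ξ => (norm_rankOne_le ξ η).trans_eq (mul_comm _ _)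

@[simp] theorem rankOneL_apply (ξ η : G.Corr) : rankOneL η ξ = rankOne ξ η := rfl

theorem smul_add_right (a : C₀(V, ℂ)) (ξ η : G.Corr) : a • (ξ + η) = a • ξ + a • η := by
  ext e; simp [add_mul]

theorem complex_smul_comm (a : C₀(V, ℂ)) (c : ℂ) (ξ : G.Corr) : a • (c • ξ) = c • (a • ξ) := by
  ext e; simp [mul_assoc]

/-- Linearity over the right action of the coefficient algebra. -/
def IsRightLinear (S : G.Corr →L[ℂ] G.Corr) : Prop :=
  ∀ (a : C₀(V, ℂ)) (ξ : G.Corr), S (a • ξ) = a • S ξ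

theorem isRightLinear_rankOne (ξ η : G.Corr) : IsRightLinear (rankOne ξ η) := fun a ζ => by
  ext e
  simp [ip_smul_right]
  ring

theorem continuous_right_smul (a : C₀(V, ℂ)) : Continuous fun ξ : G.Corr => a • ξ :=
  (LinearMap.mkContinuous (σ := RingHom.id ℂ)
    { toFun := fun ξ : G.Corr => a • ξ
      map_add' := smul_add_right a
      map_smul' := complex_smul_comm a } ‖a‖
    fun ξ => norm_smul_le_right a ξ).continuous

/-- Induction principle for generalized compact operators. -/
theorem compactOps_induction {P : (G.Corr →L[ℂ] G.Corr) → Prop}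
    (hclosed : IsClosed {T | P T}) (hzero : P 0) (hadd : ∀ S T, P S → P T → P (S + T))
    (hsmul : ∀ (c : ℂ) T, P T → P (c • T)) (hrank : ∀ ξ η, P (rankOne ξ η))
    {T : G.Corr →L[ℂ] G.Corr} (hT : T ∈ compactOps G) : P T := by
  refine closure_minimal (fun S hS => ?_) hclosed hT
  induction hS using Submodule.span_induction with
  | mem S h => obtain ⟨ξ, η, rfl⟩ := h; exact hrank ξ η
  | zero => exact hzero
  | add S T _ _ h₁ h₂ => exact hadd S T h₁ h₂
  | smul c T _ h => exact hsmul c T h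

/-- Right linearity is a closed linear condition that holds for rank one operators. It is all that
the construction of `S ⊗ 1` below requires of `S`; adjointability is not used there. -/
theorem isRightLinear_of_mem {T : G.Corr →L[ℂ] G.Corr} (hT : T ∈ compactOps G) :
    IsRightLinear T := by
  refine compactOps_induction (P := IsRightLinear) ?_ ?_ ?_ ?_ isRightLinear_rankOne hT
  · simp only [IsRightLinear, Set.ofPred_forall]
    refine isClosed_iInter fun a => isClosed_iInter fun ξ => isClosed_eq (by fun_prop) ?_
    exact (continuous_right_smul a).comp (by fun_prop)
  · intro a ξ; ext e; simp
  · intro S T hS hT a ξ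
    simp [hS a ξ, hT a ξ, smul_add_right]
  · intro c T hT a ξ
    simp [hT a ξ, complex_smul_comm]

theorem comp_rankOne {S : G.Corr →L[ℂ] G.Corr} (hS : IsRightLinear S) (ξ η : G.Corr) :
    S.comp (rankOne ξ η) = rankOne (S ξ) η :=
  ContinuousLinearMap.ext fun ζ => hS (ip η ζ) ξ

theorem comp_mem_compactOps {S T : G.Corr →L[ℂ] G.Corr} (hS : IsRightLinear S)
    (hT : T ∈ compactOps G) : S.comp T ∈ compactOps G := by
  refine compactOps_induction (P := fun T => S.comp T ∈ compactOps G) ?_ ?_ ?_ ?_ ?_ hT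
  · exact (Submodule.isClosed_topologicalClosure _).preimage
      (ContinuousLinearMap.compL ℂ G.Corr G.Corr G.Corr S).continuous
  · simp
  · intro T T' h h'
    rw [ContinuousLinearMap.comp_add]; exact add_mem h h'
  · intro c T h
    rw [ContinuousLinearMap.comp_smul]; exact Submodule.smul_mem _ c h
  · intro ξ η
    rw [comp_rankOne hS]; exact rankOne_mem_compactOps _ _

theorem ip_smul_smul_apply (a b : C₀(V, ℂ)) (ξ η : G.Corr) (v : V) :
    ip (a • ξ) (b • η) v = b v * (ip ξ η v * conj (a v)) := by
  rw [ip_smul_right, ip_smul_left]; rfl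

theorem re_ip_smul_self (a : C₀(V, ℂ)) (ξ : G.Corr) (v : V) :
    (ip (a • ξ) (a • ξ) v).re = ‖a v‖ ^ 2 * (ip ξ ξ v).re := by
  rw [← norm_ip_self_apply, ip_smul_smul_apply, norm_mul, norm_mul, norm_ip_self_apply,
    RCLike.norm_conj]
  ring

/-! ### Bump functions, approximate units and pointwise operator inequalities. -/

section Urysohn

variable [LocallyCompactSpace V] [T2Space V]

/-- A bump function, as an element of `C₀(V)`. -/
theorem _root_.exists_czero_bump {K U : Set V} (hK : IsCompact K) (hU : IsOpen U) (hKU : K ⊆ U) :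
    ∃ χ : C₀(V, ℂ), ∃ f : C(V, ℝ), (∀ v, χ v = f v) ∧ (∀ v, f v ∈ Set.Icc (0 : ℝ) 1) ∧
      (∀ v ∈ K, χ v = 1) ∧ HasCompactSupport χ ∧ tsupport χ ⊆ U := by
  obtain ⟨f, h1, h2, h3, h4⟩ := exists_continuousMap_one_of_isCompact_subset_isOpen hK hU hKU
  have hsub : tsupport (fun v => (f v : ℂ)) ⊆ tsupport f :=
    tsupport_comp_subset (g := fun x : ℝ => (x : ℂ)) Complex.ofReal_zero f
  have hc : HasCompactSupport (fun v => (f v : ℂ)) := h2.of_isClosed_subset isClosed_closure hsub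
  refine ⟨⟨⟨fun v => (f v : ℂ), by fun_prop⟩, hc.is_zero_at_infty⟩, f, fun v => rfl, h4,
    fun v hv => ?_, hc, hsub.trans h3⟩
  change (f v : ℂ) = 1
  simp [h1 hv]

/-- A bump equal to `1` on a compact set off which `‖f‖ < ε`. The product form of the last bound
lets it be applied to `f = ⟨ξ, ξ⟩` as well as to a function that is to be approximated. -/
theorem _root_.exists_czero_approx_unit {F : Type*} [NormedAddCommGroup F] (f : C₀(V, F))
    {ε : ℝ} (hε : 0 < ε) :
    ∃ χ : C₀(V, ℂ), HasCompactSupport χ ∧ (∀ v, ‖1 - χ v‖ ≤ 1) ∧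
      ∀ v, ‖f v‖ * ‖1 - χ v‖ ≤ ε := by
  have hev := f.zero_at_infty'.norm.eventually (gt_mem_nhds (by simpa using hε))
  obtain ⟨K, hK, hKf⟩ := mem_cocompact.1 hev
  obtain ⟨χ, g, hχ, hg, h1, hc, -⟩ := exists_czero_bump hK isOpen_univ (Set.subset_univ _)
  have hle : ∀ v, ‖1 - χ v‖ ≤ 1 := fun v => by
    rw [hχ, ← Complex.ofReal_one, ← Complex.ofReal_sub, Complex.norm_real, Real.norm_eq_abs,
      abs_le]
    constructor <;> linarith [(hg v).1, (hg v).2]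
  refine ⟨χ, hc, hle, fun v => ?_⟩
  by_cases hv : v ∈ K
  · simp [h1 v hv, hε.le]
  · have h2 : ‖f v‖ < ε := hKf hv
    calc _ ≤ ‖f v‖ * 1 := by gcongr; exact hle v
      _ ≤ ε := by rw [mul_one]; exact h2.le

/-- `X` is nondegenerate for the right action. -/
theorem dense_span_right_smul :
    (Submodule.span ℂ {x : G.Corr | ∃ (ξ : G.Corr) (a : C₀(V, ℂ)), x = a • ξ}).topologicalClosure
      = ⊤ := by
  refine Submodule.eq_top_iff'.2 fun ξ => ?_
  refine Metric.mem_closure_iff.2 fun ε hε => ?_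
  -- The tolerance is squared because the norm of `X` is a square root: `⟨ξ - ξχ, ξ - ξχ⟩ = |1 - χ|²
  -- ⟨ξ, ξ⟩ ≤ |1 - χ| ⟨ξ, ξ⟩`.
  obtain ⟨χ, -, h1, h2⟩ := exists_czero_approx_unit (ip ξ ξ) (ε := (ε / 2) ^ 2) (by positivity)
  refine ⟨χ • ξ, Submodule.subset_span ⟨ξ, χ, rfl⟩, ?_⟩
  rw [dist_eq_norm]
  refine lt_of_le_of_lt (norm_le_of_re_ip_self_le (c := ε / 2) (by positivity) fun v => ?_)
    (half_lt_self hε)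
  have hs : HasSum (fun e : {e : E // G.s e = v} => ‖(ξ - χ • ξ) e‖ ^ 2)
      (‖1 - χ v‖ ^ 2 * (ip ξ ξ v).re) :=
    hasSum_of_eq ((hasSum_ip_self ξ v).mul_left (‖1 - χ v‖ ^ 2)) (fun e => by
      rw [sub_apply, right_smul_apply, e.2, ← mul_pow, ← norm_mul]; ring_nf) rfl
  rw [(hasSum_ip_self _ v).unique hs, ← norm_ip_self_apply, sq, mul_assoc]
  refine (mul_le_of_le_one_left (by positivity) (h1 v)).trans ?_
  rw [mul_comm]; exact h2 v

/-- A bounded right linear operator satisfies `⟨Sξ, Sξ⟩ ≤ ‖S‖² ⟨ξ, ξ⟩`. -/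
theorem re_ip_apply_le {S : G.Corr →L[ℂ] G.Corr} (hS : IsRightLinear S) (ξ : G.Corr) (v : V) :
    (ip (S ξ) (S ξ) v).re ≤ ‖S‖ ^ 2 * (ip ξ ξ v).re := by
  refine le_of_forall_pos_le_add fun ε hε => ?_
  set c := (ip ξ ξ v).re with hc
  obtain ⟨δ, hδ, hδε⟩ : ∃ δ > 0, ‖S‖ ^ 2 * δ ≤ ε :=
    ⟨ε / (‖S‖ ^ 2 + 1), by positivity, by
      rw [mul_div_assoc', div_le_iff₀ (by positivity)]; nlinarith⟩
  -- Localization at `v`: a bump `χ` with `χ(v) = 1`, supported where `⟨ξ, ξ⟩ < c + δ`, gives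
  -- `‖ξ·χ‖² ≤ c + δ`. By right linearity `S(ξ·χ) = S(ξ)·χ`, which has the same inner square at `v`
  -- as `Sξ`.
  have hU : IsOpen {w | (ip ξ ξ w).re < c + δ} :=
    isOpen_lt (Complex.continuous_re.comp (ip ξ ξ).continuous) continuous_const
  obtain ⟨χ, g, hχ, hg, h1, -, h2⟩ := exists_czero_bump (K := {v}) isCompact_singleton hU
    (Set.singleton_subset_iff.2 (lt_add_of_pos_right c hδ))
  have hn : ‖χ • ξ‖ ^ 2 ≤ c + δ := by
    have hcd : 0 ≤ c + δ := add_nonneg (re_ip_self_nonneg ξ v) hδ.le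
    rw [← Real.sq_sqrt hcd]
    refine pow_le_pow_left₀ (norm_nonneg _) ?_ 2
    refine norm_le_of_re_ip_self_le (Real.sqrt_nonneg _) fun w => ?_
    rw [Real.sq_sqrt hcd, re_ip_smul_self]
    by_cases hw : w ∈ tsupport χ
    · have h3 : ‖χ w‖ ≤ 1 := by
        rw [hχ, Complex.norm_real, Real.norm_of_nonneg (hg w).1]; exact (hg w).2
      calc _ ≤ 1 * (ip ξ ξ w).re := by
            gcongr
            · exact re_ip_self_nonneg ξ w
            · exact pow_le_one₀ (norm_nonneg _) h3
        _ ≤ c + δ := by rw [one_mul]; exact le_of_lt (h2 hw)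
    · rw [image_eq_zero_of_notMem_tsupport hw]; simpa using hcd
  have h3 : (ip (S ξ) (S ξ) v).re ≤ ‖S (χ • ξ)‖ ^ 2 := by
    have := re_ip_self_le (χ • S ξ) v
    rwa [re_ip_smul_self, h1 v rfl, norm_one, one_pow, one_mul, ← hS] at this
  have h4 : ‖S (χ • ξ)‖ ^ 2 ≤ ‖S‖ ^ 2 * ‖χ • ξ‖ ^ 2 := by
    rw [← mul_pow]; exact pow_le_pow_left₀ (norm_nonneg _) (S.le_opNorm _) 2
  nlinarith [sq_nonneg ‖S‖]

end Urysohn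

section Adjoint

/-- A right linear operator and its adjoint have comparable norms. -/
theorem norm_le_of_adjoint {S T : G.Corr →L[ℂ] G.Corr}
    (h : ∀ ξ η, ip (S ξ) η = ip ξ (T η)) : ‖T‖ ≤ ‖S‖ := by
  refine T.opNorm_le_bound (norm_nonneg _) fun η => ?_
  have h1 : ‖T η‖ ^ 2 ≤ (‖S‖ * ‖η‖) * ‖T η‖ := by
    rw [norm_sq_eq, ← h]
    calc _ ≤ ‖S (T η)‖ * ‖η‖ := CStarModule.norm_inner_le (A := C₀(V, ℂ)) G.Corr
      _ ≤ (‖S‖ * ‖T η‖) * ‖η‖ := by gcongr; exact S.le_opNorm _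
      _ = _ := by ring
  by_contra! hlt
  have h2 : 0 < ‖T η‖ := lt_of_le_of_lt (by positivity) hlt
  nlinarith

theorem ip_rankOne_left (ξ η ζ ω : G.Corr) : ip (rankOne ξ η ζ) ω = ip ζ (rankOne η ξ ω) := by
  rw [rankOne_apply, rankOne_apply, ip_smul_left, ip_smul_right, star_ip]

end Adjoint

end Corr
end TopGraph

/-! ### Completeness of the correspondence, through its fibrewise `ℓ²` picture. -/

namespace TopGraph
namespace Corr

variable {V E : Type*} [TopologicalSpace V] [TopologicalSpace E] {G : TopGraph V E} [T2Space E]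

/-- The restriction of `ξ` to the fibre over `v`. -/
noncomputable def fiberVec (ξ : G.Corr) (v : V) : lp (fun _ : {e : E // G.s e = v} => ℂ) 2 :=
  ⟨fun e => ξ e, memℓp_gen (by simpa using (hasSum_ip_self ξ v).summable)⟩

theorem norm_fiberVec_sq (ξ : G.Corr) (v : V) : ‖fiberVec ξ v‖ ^ 2 = (ip ξ ξ v).re := by
  have h := lp.hasSum_norm (p := 2) (by norm_num) (fiberVec ξ v)
  simp only [ENNReal.toReal_ofNat, Real.rpow_ofNat] at h
  exact h.unique (hasSum_ip_self ξ v)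

theorem norm_fiberVec_le (ξ : G.Corr) (v : V) : ‖fiberVec ξ v‖ ≤ ‖ξ‖ :=
  (sq_le_sq₀ (norm_nonneg _) (norm_nonneg _)).1
    ((norm_fiberVec_sq ξ v).trans_le (re_ip_self_le ξ v))

/-- The family of restrictions of `ξ` to the fibres of the source map. -/
noncomputable def fiberVecs (ξ : G.Corr) :
    lp (fun v : V => lp (fun _ : {e : E // G.s e = v} => ℂ) 2) ⊤ :=
  ⟨fun v => fiberVec ξ v, memℓp_infty ⟨‖ξ‖, by
    rintro _ ⟨v, rfl⟩
    exact norm_fiberVec_le ξ v⟩⟩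

theorem fiberVecs_sub (ξ η : G.Corr) : fiberVecs (ξ - η) = fiberVecs ξ - fiberVecs η := rfl

theorem norm_fiberVecs (ξ : G.Corr) : ‖fiberVecs ξ‖ = ‖ξ‖ := by
  refine le_antisymm (lp.norm_le_of_forall_le (norm_nonneg _) fun v => norm_fiberVec_le ξ v) ?_
  refine norm_le_of_re_ip_self_le (norm_nonneg _) fun v => ?_
  rw [← norm_fiberVec_sq]
  exact pow_le_pow_left₀ (norm_nonneg _) (lp.norm_apply_le_norm ENNReal.top_ne_zero
    (fiberVecs ξ) v) 2

theorem isometry_fiberVecs : Isometry (fiberVecs : G.Corr → _) :=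
  Isometry.of_dist_eq fun ξ η => by
    rw [dist_eq_norm, dist_eq_norm, ← fiberVecs_sub, norm_fiberVecs]

theorem norm_ip_le (ξ η : G.Corr) : ‖ip ξ η‖ ≤ ‖ξ‖ * ‖η‖ :=
  CStarModule.norm_inner_le (A := C₀(V, ℂ)) G.Corr

theorem norm_ip_self_sub_le (ξ η : G.Corr) :
    ‖ip ξ ξ - ip η η‖ ≤ ‖ξ - η‖ * (‖ξ‖ + ‖η‖) := by
  have h1 : ip ξ ξ - ip η η = ip ξ (ξ - η) + ip (ξ - η) η := by
    have h2 : ip ξ (ξ - η) = ip ξ ξ - ip ξ η :=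
      CStarModule.inner_sub_right (A := C₀(V, ℂ)) (E := G.Corr)
    have h3 : ip (ξ - η) η = ip ξ η - ip η η :=
      CStarModule.inner_sub_left (A := C₀(V, ℂ)) (E := G.Corr)
    rw [h2, h3]; abel
  rw [h1]
  calc _ ≤ ‖ξ‖ * ‖ξ - η‖ + ‖ξ - η‖ * ‖η‖ :=
        (norm_add_le _ _).trans (add_le_add (norm_ip_le _ _) (norm_ip_le _ _))
    _ = _ := by ring

/-- A Cauchy sequence converges in the `ℓ^∞`-sum of the spaces `ℓ²(s⁻¹(v))`, and the limit must be
seen to come from `X`. It is a continuous function because the norm dominates the uniform norm, and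
its fibre sums lie in `C₀(V)` because they are the limit of `⟨u_n, u_n⟩`. -/
instance : CompleteSpace G.Corr := by
  refine Metric.complete_of_cauchySeq_tendsto fun u hu => ?_
  obtain ⟨g, hg⟩ := cauchySeq_tendsto_of_complete (isometry_fiberVecs.uniformContinuous.comp_cauchySeq hu)
  obtain ⟨C, hC⟩ : ∃ C, ∀ n, ‖u n‖ ≤ C := by
    obtain ⟨C, hC⟩ := hu.isBounded_range.exists_norm_le
    exact ⟨C, fun n => hC _ ⟨n, rfl⟩⟩
  have hC0 : 0 ≤ C := (norm_nonneg _).trans (hC 0)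
  have hip : CauchySeq fun n => ip (u n) (u n) := by
    refine Metric.cauchySeq_iff.2 fun ε hε => ?_
    -- The sum of two norms is at most `2 * C`; the extra `1` keeps the denominator positive.
    obtain ⟨N, hN⟩ := Metric.cauchySeq_iff.1 hu (ε / (2 * C + 1)) (by positivity)
    refine ⟨N, fun m hm n hn => ?_⟩
    rw [dist_eq_norm]
    have h1 := hN m hm n hn
    rw [dist_eq_norm, lt_div_iff₀ (by positivity)] at h1
    refine lt_of_le_of_lt ((norm_ip_self_sub_le _ _).trans ?_) h1
    exact mul_le_mul_of_nonneg_left (by linarith [hC m, hC n]) (norm_nonneg _)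
  obtain ⟨f, hf⟩ := cauchySeq_tendsto_of_complete hip
  have hfib : ∀ v, Tendsto (fun n => fiberVec (u n) v) atTop (𝓝 (g v)) := fun v => by
    refine tendsto_iff_norm_sub_tendsto_zero.2
      (squeeze_zero (fun _ => norm_nonneg _) (fun n => ?_) (tendsto_iff_norm_sub_tendsto_zero.1 hg))
    exact lp.norm_apply_le_norm ENNReal.top_ne_zero (fiberVecs (u n) - g) v
  have hfv : ∀ v, ‖g v‖ ^ 2 = (f v).re := fun v => by
    refine tendsto_nhds_unique ((hfib v).norm.pow 2) ?_
    simp only [norm_fiberVec_sq]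
    refine (Complex.continuous_re.tendsto _).comp ?_
    refine tendsto_iff_norm_sub_tendsto_zero.2
      (squeeze_zero (fun _ => norm_nonneg _) (fun n => ?_) (tendsto_iff_norm_sub_tendsto_zero.1 hf))
    exact (ip (u n) (u n) - f).toBCF.norm_coe_le_norm v
  let ξ₀ : E → ℂ := fun e => g (G.s e) ⟨e, rfl⟩
  have hξ₀ : ∀ v (e : {e : E // G.s e = v}), ξ₀ e = g v e := by
    rintro v ⟨e, rfl⟩; rfl
  have hunif : TendstoUniformly (fun n e => u n e) ξ₀ atTop := by
    refine Metric.tendstoUniformly_iff.2 fun ε hε => ?_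
    filter_upwards [Metric.tendsto_nhds.1 hg ε hε] with n hn e
    rw [dist_comm]
    refine lt_of_le_of_lt ?_ hn
    rw [dist_eq_norm, dist_eq_norm]
    refine le_trans ?_ (lp.norm_apply_le_norm ENNReal.top_ne_zero (fiberVecs (u n) - g) (G.s e))
    exact lp.norm_apply_le_norm (by norm_num) (fiberVec (u n) (G.s e) - g (G.s e)) ⟨e, rfl⟩
  have hcont : Continuous ξ₀ := hunif.continuous (.of_forall fun n => (u n).continuous_coe)
  refine ⟨mk ξ₀ hcont ⟨⟨⟨fun v => (f v).re, by fun_prop⟩, ?_⟩, fun v => ?_⟩, ?_⟩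
  · simpa [Function.comp_def] using (Complex.continuous_re.tendsto 0).comp f.zero_at_infty'
  · have h := lp.hasSum_norm (p := 2) (by norm_num) (g v)
    simp only [ENNReal.toReal_ofNat, Real.rpow_ofNat, hfv] at h
    exact hasSum_of_eq h (fun e => congrArg (fun z : ℂ => ‖z‖ ^ 2) (hξ₀ v e).symm) rfl
  · refine isometry_fiberVecs.isEmbedding.tendsto_nhds_iff.2 ?_
    convert hg using 2
    ext v e
    exact hξ₀ v e

end Corr
end TopGraph

/-! ### Products in the product system and the operators `ι_p^q`. -/

namespace TopologicalKGraph

open TopGraph TopGraph.Corr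

variable {k : ℕ} {V M : Type*} [TopologicalSpace V] [TopologicalSpace M]
  (Λ : TopologicalKGraph k V M) [T2Space M]

section Products

variable {m n q : Fin k → ℕ} (h : m + n = q)

theorem mul_add_left (ξ ξ' : Λ.Fib m) (η : Λ.Fib n) :
    Λ.mul h (ξ + ξ') η = Λ.mul h ξ η + Λ.mul h ξ' η := by
  ext μ; simp [add_mul]

theorem mul_smul_left (c : ℂ) (ξ : Λ.Fib m) (η : Λ.Fib n) :
    Λ.mul h (c • ξ) η = c • Λ.mul h ξ η := by
  ext μ; simp [mul_assoc]

/-- A finite sum of products `ξ η`, fibrewise: the fibre of `X_q` over `v` is the sum of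
the fibres of `X_m` over the ranges of the paths of degree `n` with source `v`. -/
theorem hasSum_ip_sum_mul {ι : Type*} (s : Finset ι) (ξ : ι → Λ.Fib m) (η : ι → Λ.Fib n) (v : V) :
    HasSum (fun ν : {ν : Λ.Path n // Λ.s ν = v} =>
        (ip (∑ i ∈ s, η i ν.1 • ξ i) (∑ i ∈ s, η i ν.1 • ξ i) (Λ.r ν.1)).re)
      (ip (∑ i ∈ s, Λ.mul h (ξ i) (η i)) (∑ i ∈ s, Λ.mul h (ξ i) (η i)) v).re := by
  have h1 := hasSum_ip_self (∑ i ∈ s, Λ.mul h (ξ i) (η i)) v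
  have h2 : HasSum (fun p : Σ ν : {ν : Λ.Path n // Λ.s ν = v},
      {κ : Λ.Path m // Λ.s κ = Λ.r ν.1} => ‖(∑ i ∈ s, η i p.1.1 • ξ i) p.2.1‖ ^ 2)
      (ip (∑ i ∈ s, Λ.mul h (ξ i) (η i)) (∑ i ∈ s, Λ.mul h (ξ i) (η i)) v).re := by
    refine (Λ.fiberEquiv h v).hasSum_iff.1 (hasSum_of_eq h1 (fun μ => ?_) rfl)
    rw [Corr.sum_apply]
    change _ = ‖(∑ i ∈ s, η i (Λ.tail h μ.1) • ξ i) (Λ.head h μ.1)‖ ^ 2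
    rw [Corr.sum_apply]
    simp only [mul_apply, Corr.smul_apply, mul_comm]
  exact h2.sigma fun ν => hasSum_ip_self _ (Λ.r ν.1)

/-- Sum over the paths with source `v` by fixing the final segment first; the inner sum over initial
segments is `⟨ξ, ξ'⟩` at the range of that segment. This is the inner product of the balanced tensor
product `X_m ⊗ X_n`. -/
theorem ip_mul_mul (ξ ξ' : Λ.Fib m) (η η' : Λ.Fib n) :
    ip (Λ.mul h ξ η) (Λ.mul h ξ' η') = ip η (Λ.phi n (ip ξ ξ') η') := by
  ext v
  have h1 := hasSum_ip (Λ.mul h ξ η) (Λ.mul h ξ' η') v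
  have h2 : HasSum (fun p : Σ ν : {ν : Λ.Path n // Λ.s ν = v},
      {κ : Λ.Path m // Λ.s κ = Λ.r ν.1} =>
        conj (ξ p.2.1) * ξ' p.2.1 * (conj (η p.1.1) * η' p.1.1))
      (ip (Λ.mul h ξ η) (Λ.mul h ξ' η') v) := by
    refine (Λ.fiberEquiv h v).hasSum_iff.1 (hasSum_of_eq h1 (fun μ => ?_) rfl)
    change _ = conj (ξ (Λ.head h μ.1)) * ξ' (Λ.head h μ.1) *
      (conj (η (Λ.tail h μ.1)) * η' (Λ.tail h μ.1))
    simp only [mul_apply, map_mul]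
    ring
  have h3 : HasSum (fun ν : {ν : Λ.Path n // Λ.s ν = v} =>
      ip ξ ξ' (Λ.r ν.1) * (conj (η ν.1) * η' ν.1)) (ip (Λ.mul h ξ η) (Λ.mul h ξ' η') v) :=
    h2.sigma fun ν => (hasSum_ip ξ ξ' (Λ.r ν.1)).mul_right (conj (η ν.1) * η' ν.1)
  have h4 : HasSum (fun ν : {ν : Λ.Path n // Λ.s ν = v} =>
      ip ξ ξ' (Λ.r ν.1) * (conj (η ν.1) * η' ν.1)) (ip η (Λ.phi n (ip ξ ξ') η') v) :=
    hasSum_of_eq (hasSum_ip η (Λ.phi n (ip ξ ξ') η') v)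
      (fun ν => mul_left_comm (conj (η ν.1)) (ip ξ ξ' (Λ.r ν.1)) (η' ν.1)) rfl
  exact h3.unique h4

theorem norm_mul_le (ξ : Λ.Fib m) (η : Λ.Fib n) : ‖Λ.mul h ξ η‖ ≤ ‖ξ‖ * ‖η‖ := by
  refine (sq_le_sq₀ (norm_nonneg _) (by positivity)).1 ?_
  rw [norm_sq_eq, ip_mul_mul, mul_pow, norm_sq_eq ξ]
  calc _ ≤ ‖η‖ * ‖Λ.phi n (ip ξ ξ) η‖ := norm_ip_le _ _
    _ ≤ ‖η‖ * (‖ip ξ ξ‖ * ‖η‖) := by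
        gcongr
        exact ((Λ.phi n (ip ξ ξ)).le_opNorm _).trans (by gcongr; exact norm_leftAct_le _)
    _ = _ := by ring

/-- Multiplication by `η` on the right as a continuous linear map. -/
noncomputable def mulRightL (η : Λ.Fib n) : Λ.Fib m →L[ℂ] Λ.Fib q :=
  LinearMap.mkContinuous (σ := RingHom.id ℂ)
    { toFun := fun ξ => Λ.mul h ξ η
      map_add' := fun ξ ξ' => Λ.mul_add_left h ξ ξ' η
      map_smul' := fun c ξ => Λ.mul_smul_left h c ξ η } ‖η‖
    fun ξ => (Λ.norm_mul_le h ξ η).trans_eq (mul_comm _ _)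

@[simp] theorem mulRightL_apply (ξ : Λ.Fib m) (η : Λ.Fib n) :
    Λ.mulRightL h η ξ = Λ.mul h ξ η := rfl

/-- The products `ξ η` span a dense subspace of `X_q`. -/
def ProductsDense : Prop :=
  (Submodule.span ℂ (Set.range fun x : Λ.Fib m × Λ.Fib n => Λ.mul h x.1 x.2)).topologicalClosure = ⊤

variable {Λ h}

theorem ProductsDense.ext (hd : Λ.ProductsDense h) {R R' : Λ.Fib q →L[ℂ] Λ.Fib q}
    (hR : ∀ ξ η, R (Λ.mul h ξ η) = R' (Λ.mul h ξ η)) : R = R' := by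
  refine ContinuousLinearMap.ext_on (s := Set.range fun x : Λ.Fib m × Λ.Fib n =>
    Λ.mul h x.1 x.2) (Submodule.dense_iff_topologicalClosure_eq_top.2 hd) ?_
  rintro _ ⟨x, rfl⟩
  exact hR _ _

/-- For bounded right linear `S` the operator `S ⊗ 1` on `X_q` exists and has norm at
most `‖S‖`. -/
theorem ProductsDense.exists_tensor_one [LocallyCompactSpace V] [T2Space V]
    (hd : Λ.ProductsDense h) {S : Λ.Fib m →L[ℂ] Λ.Fib m} (hS : IsRightLinear S) :
    ∃ R : Λ.Fib q →L[ℂ] Λ.Fib q, (∀ ξ η, R (Λ.mul h ξ η) = Λ.mul h (S ξ) η) ∧ ‖R‖ ≤ ‖S‖ := by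
  -- Formal combinations of pairs replace the span of the products. The bound `‖f c‖ ≤ ‖S‖ ‖e c‖`
  -- then gives both that `S ⊗ 1` is well defined and that it is continuous.
  let e := Finsupp.linearCombination ℂ fun x : Λ.Fib m × Λ.Fib n => Λ.mul h x.1 x.2
  let f := Finsupp.linearCombination ℂ fun x : Λ.Fib m × Λ.Fib n => Λ.mul h (S x.1) x.2
  have hdense : DenseRange e := by
    have h1 := Submodule.dense_iff_topologicalClosure_eq_top.2 hd
    rw [← Finsupp.range_linearCombination] at h1
    exact h1
  have he : ∀ c, e c = ∑ x ∈ c.support, Λ.mul h (c x • x.1) x.2 := fun c => by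
    simp only [mul_smul_left]
    exact Finsupp.linearCombination_apply ℂ c
  have hf : ∀ c, f c = ∑ x ∈ c.support, Λ.mul h (S (c x • x.1)) x.2 := fun c => by
    simp only [map_smul, mul_smul_left]
    exact Finsupp.linearCombination_apply ℂ c
  have hle : ∀ c, ‖f c‖ ≤ ‖S‖ * ‖e c‖ := fun c => by
    refine norm_le_of_re_ip_self_le (by positivity) fun v => ?_
    rw [mul_pow]
    refine le_trans ?_ (mul_le_mul_of_nonneg_left (re_ip_self_le (e c) v) (by positivity))
    rw [he, hf]
    refine hasSum_le (fun ν => ?_) (Λ.hasSum_ip_sum_mul h _ _ _ v)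
      ((Λ.hasSum_ip_sum_mul h _ _ _ v).mul_left (‖S‖ ^ 2))
    -- For a fixed final segment `t` the values of the second factors at `t` are complex scalars, so
    -- `S` passes through the sum and `re_ip_apply_le` applies at the range of `t`.
    have h1 : ∀ t : Λ.Path n, ∑ x ∈ c.support, x.2 t • S (c x • x.1)
        = S (∑ x ∈ c.support, x.2 t • c x • x.1) := fun t => by
      rw [map_sum]; simp only [map_smul]
    rw [h1]
    exact re_ip_apply_le hS _ _
  refine ⟨f.extendOfNorm e, fun ξ η => ?_, LinearMap.opNorm_extendOfNorm_le hdense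
    (norm_nonneg _) hle⟩
  have h1 := LinearMap.extendOfNorm_eq hdense ⟨‖S‖, hle⟩ (Finsupp.single (ξ, η) 1)
  have h2 : e (Finsupp.single (ξ, η) 1) = Λ.mul h ξ η := by simp [e]
  have h3 : f (Finsupp.single (ξ, η) 1) = Λ.mul h (S ξ) η := by simp [f]
  rwa [h2, h3] at h1

end Products

section Iota

variable {Λ} {p q : Fin k → ℕ}

/-- The chosen operator and `R` agree on products, hence everywhere by density. This rules out the
default value `0` in `iota` once some `R` is known. -/
theorem iota_eq (hpq : p ≤ q) (hd : Λ.ProductsDense (add_tsub_cancel_of_le hpq))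
    {S : Λ.Fib p →L[ℂ] Λ.Fib p} {R : Λ.Fib q →L[ℂ] Λ.Fib q}
    (hR : ∀ ξ η, R (Λ.mul (add_tsub_cancel_of_le hpq) ξ η)
      = Λ.mul (add_tsub_cancel_of_le hpq) (S ξ) η) : Λ.iota p q S = R := by
  have hex : ∃ hpq : p ≤ q, ∃ R : Λ.Fib q →L[ℂ] Λ.Fib q, ∀ (ξ : Λ.Fib p) (η : Λ.Fib (q - p)),
      R (Λ.mul (add_tsub_cancel_of_le hpq) ξ η) = Λ.mul (add_tsub_cancel_of_le hpq) (S ξ) η :=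
    ⟨hpq, R, hR⟩
  refine hd.ext fun ξ η => ?_
  rw [hR, iota, dif_pos hex]
  exact hex.choose_spec.choose_spec ξ η

/-- If `φ(a)` is the rank one operator `Θ_{ζ,ω}`, then `ι(Θ_{ξ·a,η}) = Θ_{ξζ,ηω}`. -/
theorem iota_rankOne (hpq : p ≤ q) (hd : Λ.ProductsDense (add_tsub_cancel_of_le hpq))
    (ξ η : Λ.Fib p) {a : C₀(V, ℂ)} {ζ ω : Λ.Fib (q - p)} (ha : Λ.phi (q - p) a = rankOne ζ ω) :
    Λ.iota p q (rankOne (a • ξ) η) = rankOne (Λ.mul (add_tsub_cancel_of_le hpq) ξ ζ)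
      (Λ.mul (add_tsub_cancel_of_le hpq) η ω) := by
  refine iota_eq hpq hd fun α β => ?_
  rw [rankOne_apply, ip_mul_mul]
  have h1 : ip ω (Λ.phi (q - p) (ip η α) β) • ζ
      = Λ.phi (q - p) a (Λ.phi (q - p) (ip η α) β) := by
    rw [ha, rankOne_apply]
  ext μ
  -- The identity for `φ(a)` is read at the final segment of `μ`; there `a` is evaluated at the
  -- range of that segment, which is the source of the initial one, so it becomes the right action
  -- on `ξ`.
  have h2 := DFunLike.congr_fun h1 (Λ.tail (add_tsub_cancel_of_le hpq) μ)
  simp only [right_smul_apply, leftAct_apply] at h2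
  have h3 : (Λ.graph (q - p)).s (Λ.tail (add_tsub_cancel_of_le hpq) μ) = (Λ.graph q).s μ :=
    Λ.s_tail _ μ
  have h4 : (Λ.graph p).s (Λ.head (add_tsub_cancel_of_le hpq) μ)
      = (Λ.graph (q - p)).r (Λ.tail (add_tsub_cancel_of_le hpq) μ) := Λ.s_head _ μ
  rw [h3] at h2
  simp only [right_smul_apply, mul_apply, rankOne_apply_apply, mul_assoc, h2, h4]

variable [LocallyCompactSpace V] [T2Space V]

theorem iota_mul (hpq : p ≤ q) (hd : Λ.ProductsDense (add_tsub_cancel_of_le hpq))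
    {S : Λ.Fib p →L[ℂ] Λ.Fib p} (hS : IsRightLinear S) (ξ : Λ.Fib p) (η : Λ.Fib (q - p)) :
    Λ.iota p q S (Λ.mul (add_tsub_cancel_of_le hpq) ξ η)
      = Λ.mul (add_tsub_cancel_of_le hpq) (S ξ) η := by
  obtain ⟨R, hR, -⟩ := hd.exists_tensor_one hS
  rw [iota_eq hpq hd hR, hR]

/-- `ι_p^q` as a continuous linear map on the generalized compact operators. -/
noncomputable def iotaL (hpq : p ≤ q) (hd : Λ.ProductsDense (add_tsub_cancel_of_le hpq)) :
    Λ.compacts p →L[ℂ] Λ.Fib q →L[ℂ] Λ.Fib q :=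
  LinearMap.mkContinuous (σ := RingHom.id ℂ)
    { toFun := fun S => Λ.iota p q S
      map_add' := fun S T => iota_eq hpq hd fun ξ η => by
        change Λ.iota p q S _ + Λ.iota p q T _ = _
        rw [iota_mul hpq hd (isRightLinear_of_mem S.2), iota_mul hpq hd (isRightLinear_of_mem T.2),
          ← mul_add_left]
        rfl
      map_smul' := fun c S => iota_eq hpq hd fun ξ η => by
        change c • Λ.iota p q S _ = _
        rw [iota_mul hpq hd (isRightLinear_of_mem S.2), ← mul_smul_left]
        rfl } 1
    fun S => by
      obtain ⟨R, hR, hn⟩ := hd.exists_tensor_one (isRightLinear_of_mem S.2)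
      rw [one_mul]
      change ‖Λ.iota p q S‖ ≤ ‖S‖
      rw [iota_eq hpq hd hR]
      exact hn

@[simp] theorem iotaL_apply (hpq : p ≤ q) (hd : Λ.ProductsDense (add_tsub_cancel_of_le hpq))
    (S : Λ.compacts p) : iotaL hpq hd S = Λ.iota p q S := rfl

end Iota

end TopologicalKGraph
-- Existence and multiplicativity of `ψ^{(m)}` for a Toeplitz representation.
/-- Extension of a linear map from a spanning family to the closed span. -/
theorem exists_extend_topologicalClosure_span {W F ι : Type*} [NormedAddCommGroup W]
    [NormedSpace ℂ W] [NormedAddCommGroup F] [NormedSpace ℂ F] [CompleteSpace F] {s : Set W}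
    {r : ι → W} (hs : s = Set.range r) {g : ι → F}
    (h : ∀ c : ι →₀ ℂ, ‖∑ i ∈ c.support, c i • g i‖ ≤ ‖∑ i ∈ c.support, c i • r i‖) :
    ∃ f : (Submodule.span ℂ s).topologicalClosure →L[ℂ] F,
      ∀ i (hi : r i ∈ (Submodule.span ℂ s).topologicalClosure), f ⟨r i, hi⟩ = g i := by
  subst hs
  have hr : ∀ i, r i ∈ (Submodule.span ℂ (Set.range r)).topologicalClosure := fun i =>
    Submodule.le_topologicalClosure _ (Submodule.subset_span ⟨i, rfl⟩)
  let r' : ι → (Submodule.span ℂ (Set.range r)).topologicalClosure := fun i => ⟨r i, hr i⟩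
  let e := Finsupp.linearCombination ℂ r'
  let f := Finsupp.linearCombination ℂ g
  have he : ∀ c, (e c : W) = ∑ i ∈ c.support, c i • r i := fun c => by
    simp only [e, Finsupp.linearCombination_apply, Finsupp.sum]
    exact map_sum (Submodule.span ℂ (Set.range r)).topologicalClosure.subtype _ _
  have hle : ∀ c, ‖f c‖ ≤ 1 * ‖e c‖ := fun c => by
    rw [one_mul]
    change ‖f c‖ ≤ ‖(e c : W)‖
    rw [he]
    exact h c
  have hdense : DenseRange e := by
    rintro ⟨T, hT⟩
    refine closure_subtype.2 (closure_mono (s := (Submodule.span ℂ (Set.range r) : Set W)) ?_ hT)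
    intro S hS
    have hS' : S ∈ Submodule.map (Submodule.span ℂ (Set.range r)).topologicalClosure.subtype
        (LinearMap.range e) := by
      refine Submodule.span_le.2 ?_ hS
      rintro _ ⟨i, rfl⟩
      exact ⟨r' i, ⟨Finsupp.single i 1, by simp [e]⟩, rfl⟩
    obtain ⟨_, ⟨c, rfl⟩, rfl⟩ := hS'
    exact ⟨_, ⟨c, rfl⟩, rfl⟩
  refine ⟨f.extendOfNorm e, fun i hi => ?_⟩
  have h1 := LinearMap.extendOfNorm_eq hdense ⟨1, hle⟩ (Finsupp.single i 1)
  have h2 : e (Finsupp.single i 1) = r' i := by simp [e]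
  have h3 : f (Finsupp.single i 1) = g i := by simp [f]
  rwa [h2, h3] at h1

namespace TopologicalKGraph

open TopGraph TopGraph.Corr

variable {k : ℕ} {V M : Type*} [TopologicalSpace V] [TopologicalSpace M]
  {Λ : TopologicalKGraph k V M} [T2Space M] {m : Fin k → ℕ}

/-- Induction principle for generalized compact operators, as elements of the subtype. -/
theorem compacts_induction {P : Λ.compacts m → Prop}
    (hclosed : IsClosed {T | P T}) (hzero : P 0) (hadd : ∀ S T, P S → P T → P (S + T))
    (hsmul : ∀ (c : ℂ) T, P T → P (c • T))
    (hrank : ∀ ξ η, P ⟨rankOne ξ η, rankOne_mem_compactOps ξ η⟩) (T : Λ.compacts m) : P T := by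
  have hc : IsClosed {T : Λ.Fib m →L[ℂ] Λ.Fib m | ∃ h : T ∈ Λ.compacts m, P ⟨T, h⟩} := by
    have h1 := (Submodule.isClosed_topologicalClosure _ :
      IsClosed ((Λ.compacts m : Submodule ℂ _) : Set (Λ.Fib m →L[ℂ] Λ.Fib m)))
    convert h1.isClosedMap_subtype_val _ hclosed using 1
    ext T
    exact ⟨fun ⟨h, h'⟩ => ⟨⟨T, h⟩, h', rfl⟩, by rintro ⟨S, h, rfl⟩; exact ⟨S.2, h⟩⟩
  obtain ⟨_, h⟩ := compactOps_induction (P := fun T => ∃ h : T ∈ Λ.compacts m, P ⟨T, h⟩) hc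
    ⟨zero_mem _, hzero⟩ (fun S T ⟨h, h'⟩ ⟨i, i'⟩ => ⟨add_mem h i, hadd _ _ h' i'⟩)
    (fun c T ⟨h, h'⟩ => ⟨Submodule.smul_mem _ c h, hsmul c _ h'⟩)
    (fun ξ η => ⟨_, hrank ξ η⟩) T.2
  exact h

/-- Induction over the generalized compact operators, starting from the operators `Θ_{ξ·a,η}` with
`a` in a set whose closed span is `C₀(V)`. -/
theorem compacts_induction_smul [LocallyCompactSpace V] [T2Space V] {s : Set C₀(V, ℂ)}
    (hs : (Submodule.span ℂ s).topologicalClosure = ⊤) {P : Λ.compacts m → Prop}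
    (hclosed : IsClosed {T | P T}) (hzero : P 0) (hadd : ∀ S T, P S → P T → P (S + T))
    (hsmul : ∀ (c : ℂ) T, P T → P (c • T))
    (hrank : ∀ a ∈ s, ∀ ξ η : Λ.Fib m,
      P ⟨rankOne (a • ξ) η, rankOne_mem_compactOps (a • ξ) η⟩) (T : Λ.compacts m) : P T := by
  refine compacts_induction hclosed hzero hadd hsmul (fun ξ η => ?_) T
  let N : Submodule ℂ (Λ.compacts m) :=
    { carrier := {T | P T}
      zero_mem' := hzero
      add_mem' := fun h h' => hadd _ _ h h'
      smul_mem' := fun c T h => hsmul c T h }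
  let R : Λ.Fib m →L[ℂ] Λ.compacts m :=
    (rankOneL η).codRestrict (Λ.compacts m) fun ξ => rankOne_mem_compactOps ξ η
  -- Two closure arguments with `η` fixed: first in `a`, by density of the span of `s`; then in `ξ`,
  -- since the elements `ξ·a` span a dense subspace.
  have h1 : ∀ (ξ : Λ.Fib m) (a : C₀(V, ℂ)), R (a • ξ) ∈ N := fun ξ a => by
    have hle : (Submodule.span ℂ s).topologicalClosure
        ≤ N.comap (R.comp (rightActL ξ) : C₀(V, ℂ) →ₗ[ℂ] Λ.compacts m) :=
      Submodule.topologicalClosure_minimal _ (Submodule.span_le.2 fun a ha => hrank a ha ξ η)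
        (hclosed.preimage (R.comp (rightActL ξ)).continuous)
    rw [hs] at hle
    exact hle (Submodule.mem_top (x := a))
  have hle : (Submodule.span ℂ {x : Λ.Fib m | ∃ (ξ : Λ.Fib m) (a : C₀(V, ℂ)),
      x = a • ξ}).topologicalClosure ≤ N.comap (R : Λ.Fib m →ₗ[ℂ] Λ.compacts m) :=
    Submodule.topologicalClosure_minimal _
      (Submodule.span_le.2 (by rintro _ ⟨ξ, a, rfl⟩; exact h1 ξ a))
      (hclosed.preimage R.continuous)
  rw [dense_span_right_smul] at hle
  exact hle (Submodule.mem_top (x := ξ))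

/-- A continuous linear map on the generalized compact operators is determined by its values on the
operators `Θ_{ξ·a,η}`, with `a` in a set whose closed span is `C₀(V)`. -/
theorem compacts_clm_ext [LocallyCompactSpace V] [T2Space V] {s : Set C₀(V, ℂ)}
    (hs : (Submodule.span ℂ s).topologicalClosure = ⊤) {W : Type*} [NormedAddCommGroup W]
    [NormedSpace ℂ W] {f g : Λ.compacts m →L[ℂ] W}
    (h : ∀ a ∈ s, ∀ ξ η : Λ.Fib m, f ⟨rankOne (a • ξ) η, rankOne_mem_compactOps (a • ξ) η⟩
      = g ⟨rankOne (a • ξ) η, rankOne_mem_compactOps (a • ξ) η⟩) : f = g := by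
  ext1 T
  refine compacts_induction_smul hs (P := fun T => f T = g T)
    (isClosed_eq f.continuous g.continuous) ?_ ?_ ?_ h T
  · rw [map_zero, map_zero]
  · intro S T hS hT
    rw [map_add, map_add, hS, hT]
  · intro c T hT
    rw [map_smul, map_smul, hT]

namespace ToeplitzRep

variable {B : Type*} [NonUnitalCStarAlgebra B]
  (ψ : Λ.ToeplitzRep B)

theorem norm_base_le (a : C₀(V, ℂ)) : ‖ψ.base a‖ ≤ ‖a‖ :=
  NonUnitalStarAlgHom.norm_apply_le ψ.base a

theorem norm_fib_le (ξ : Λ.Fib m) : ‖ψ.fib m ξ‖ ≤ ‖ξ‖ := by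
  refine (sq_le_sq₀ (norm_nonneg _) (norm_nonneg _)).1 ?_
  rw [sq, ← CStarRing.norm_star_mul_self, ψ.fib_inner, norm_sq_eq]
  exact ψ.norm_base_le _

/-- `ψ_m` as a continuous linear map. -/
noncomputable def fibL (m : Fin k → ℕ) : Λ.Fib m →L[ℂ] B :=
  (ψ.fib m).mkContinuous 1 fun ξ => by simpa using ψ.norm_fib_le ξ

@[simp] theorem fibL_apply (ξ : Λ.Fib m) : ψ.fibL m ξ = ψ.fib m ξ := rfl

/-- `ψ_e` as a continuous linear map. -/
noncomputable def baseL : C₀(V, ℂ) →L[ℂ] B :=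
  (ψ.base : C₀(V, ℂ) →ₗ[ℂ] B).mkContinuous 1 fun a => by simpa using ψ.norm_base_le a

@[simp] theorem baseL_apply (a : C₀(V, ℂ)) : ψ.baseL a = ψ.base a := rfl

/-- The elements `ψ(ξ)ψ(η)*` act on the range of `ψ_m` as the rank one operators act on `X_m`; this
carries operator identities into `B`. -/
theorem fib_mul_star_mul_fib (ξ η ζ : Λ.Fib m) :
    ψ.fib m ξ * star (ψ.fib m η) * ψ.fib m ζ = ψ.fib m (rankOne ξ η ζ) := by
  rw [mul_assoc, ψ.fib_inner, ← ψ.fib_right]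
  rfl

/-- The constant `C` is lost on taking `N`-th roots. An unbounded set of exponents suffices, which
allows powers of two. -/
theorem _root_.le_of_forall_pow_succ_le_mul_pow {x y C : ℝ} (hy : 0 ≤ y)
    (h : ∀ n : ℕ, ∃ N ≥ n, x ^ (N + 1) ≤ C * y ^ N) : x ≤ y := by
  by_contra! hlt
  have hx' : 0 < x := hy.trans_lt hlt
  have h1 : Tendsto (fun N : ℕ => C * (y / x) ^ N) atTop (𝓝 (C * 0)) :=
    (tendsto_pow_atTop_nhds_zero_of_lt_one (by positivity) ((div_lt_one hx').2 hlt)).const_mul C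
  rw [mul_zero] at h1
  obtain ⟨n, hn⟩ := eventually_atTop.1 (h1.eventually (gt_mem_nhds hx'))
  obtain ⟨N, hN, hle⟩ := h n
  have h2 := hn N hN
  rw [div_pow, mul_div_assoc', div_lt_iff₀ (by positivity), ← pow_succ'] at h2
  exact absurd hle (not_le.2 h2)

/-- The key estimate for the existence of `ψ^{(m)}`. -/
theorem norm_sum_fib_mul_star_le (s : Finset (Λ.Fib m × Λ.Fib m)) (c : Λ.Fib m × Λ.Fib m → ℂ) :
    ‖∑ x ∈ s, c x • (ψ.fib m x.1 * star (ψ.fib m x.2))‖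
      ≤ ‖∑ x ∈ s, c x • rankOne x.1 x.2‖ := by
  -- The norm of `t` is found from powers of `u = t t*`. Left multiplication by `u` on the range of
  -- `ψ_m` is `P = T T'`, with `T'` the adjoint of `T`, and `u` is itself a finite sum of elements
  -- `ψ(Tη)ψ(ξ)*` with coefficients. Hence `‖u^(N+1)‖ ≤ C ‖T‖^(2N)` with `C` independent of `N`, and
  -- the C*-identity removes `C`.
  set t := ∑ x ∈ s, c x • (ψ.fib m x.1 * star (ψ.fib m x.2)) with ht
  set T := ∑ x ∈ s, c x • rankOne x.1 x.2 with hT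
  set T' := ∑ x ∈ s, conj (c x) • rankOne x.2 x.1 with hT'
  have ht' : star t = ∑ x ∈ s, conj (c x) • (ψ.fib m x.2 * star (ψ.fib m x.1)) := by
    simp [ht, star_sum, star_smul]
  have h1 : ∀ ζ, t * ψ.fib m ζ = ψ.fib m (T ζ) := fun ζ => by
    simp only [ht, hT, Finset.sum_mul, smul_mul_assoc, fib_mul_star_mul_fib,
      _root_.sum_apply, map_sum, _root_.smul_apply, map_smul]
  have h2 : ∀ ζ, star t * ψ.fib m ζ = ψ.fib m (T' ζ) := fun ζ => by
    simp only [ht', hT', Finset.sum_mul, smul_mul_assoc, fib_mul_star_mul_fib,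
      _root_.sum_apply, map_sum, _root_.smul_apply, map_smul]
  have hTT' : ‖T'‖ ≤ ‖T‖ := by
    refine norm_le_of_adjoint fun ξ η => ?_
    have h3 : ip (T ξ) η = ∑ x ∈ s, conj (c x) • ip (rankOne x.1 x.2 ξ) η := by
      rw [hT, _root_.sum_apply]
      refine (CStarModule.inner_sum_left (A := C₀(V, ℂ)) (E := Λ.Fib m)).trans ?_
      refine Finset.sum_congr rfl fun x _ => ?_
      exact CStarModule.inner_smul_left_complex (A := C₀(V, ℂ)) (E := Λ.Fib m)
    have h4 : ip ξ (T' η) = ∑ x ∈ s, conj (c x) • ip ξ (rankOne x.2 x.1 η) := by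
      rw [hT', _root_.sum_apply]
      refine (CStarModule.inner_sum_right (A := C₀(V, ℂ)) (E := Λ.Fib m)).trans ?_
      refine Finset.sum_congr rfl fun x _ => ?_
      exact CStarModule.inner_smul_right_complex (A := C₀(V, ℂ)) (E := Λ.Fib m)
    rw [h3, h4]
    simp only [ip_rankOne_left]
  -- `B` need not have a unit; powers are taken in the unitization, which contains `B`
  -- isometrically.
  let u : Unitization ℂ B := ((t * star t : B) : Unitization ℂ B)
  have hu : IsSelfAdjoint u := by
    change star u = u
    simp only [u, ← Unitization.inr_star, star_mul, star_star]
  let P := T.comp T'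
  have hP : ‖P‖ ≤ ‖T‖ ^ 2 := (ContinuousLinearMap.opNorm_comp_le _ _).trans (by
    rw [sq]; gcongr)
  have hpow : ∀ N ζ, u ^ N * (ψ.fib m ζ : Unitization ℂ B)
      = (ψ.fib m ((P ^ N) ζ) : Unitization ℂ B) := by
    intro N
    induction N with
    | zero => intro ζ; simp
    | succ N ih =>
      intro ζ
      rw [pow_succ, mul_assoc, ← Unitization.inr_mul, mul_assoc, h2, h1, ih]
      rfl
  set C := ∑ x ∈ s, ‖c x‖ * ‖T x.2‖ * ‖x.1‖ with hC
  have hbound : ∀ N : ℕ, ‖u ^ (N + 1)‖ ≤ C * (‖T‖ ^ 2) ^ N := by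
    intro N
    have h3 : u = ∑ x ∈ s, conj (c x) • ((ψ.fib m (T x.2) : Unitization ℂ B)
        * ((star (ψ.fib m x.1) : B) : Unitization ℂ B)) := by
      simp only [u, ht', Finset.mul_sum, mul_smul_comm, ← mul_assoc, h1, ← Unitization.inr_mul,
        ← Unitization.inr_smul]
      exact map_sum (Unitization.inrNonUnitalAlgHom ℂ B) _ _
    have h4 : u ^ (N + 1) = ∑ x ∈ s, conj (c x) • ((ψ.fib m ((P ^ N) (T x.2)) : Unitization ℂ B)
        * ((star (ψ.fib m x.1) : B) : Unitization ℂ B)) := by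
      rw [pow_succ]
      nth_rewrite 2 [h3]
      simp only [Finset.mul_sum, mul_smul_comm, ← mul_assoc, hpow]
    rw [h4, hC, Finset.sum_mul]
    refine norm_sum_le_of_le _ fun x _ => ?_
    rw [norm_smul, RCLike.norm_conj]
    have h5 : ‖(P ^ N) (T x.2)‖ ≤ (‖T‖ ^ 2) ^ N * ‖T x.2‖ := by
      refine ((P ^ N).le_opNorm _).trans ?_
      gcongr
      refine le_trans ?_ (pow_le_pow_left₀ (norm_nonneg _) hP N)
      -- The exponent `0` is separate because `X_m` may be zero, so that only `‖1‖ ≤ 1` is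
      -- available.
      rcases N with _ | N
      · rw [pow_zero, pow_zero]
        exact ContinuousLinearMap.norm_id_le
      · exact norm_pow_le' _ N.succ_pos
    calc _ ≤ ‖c x‖ * (‖ψ.fib m ((P ^ N) (T x.2))‖ * ‖ψ.fib m x.1‖) := by
          gcongr
          refine (_root_.norm_mul_le _ _).trans_eq ?_
          rw [Unitization.norm_inr, Unitization.norm_inr, norm_star]
      _ ≤ ‖c x‖ * (((‖T‖ ^ 2) ^ N * ‖T x.2‖) * ‖x.1‖) := by
          gcongr
          · exact (ψ.norm_fib_le _).trans h5
          · exact ψ.norm_fib_le _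
      _ = _ := by ring
  have hfin : ‖u‖ ≤ ‖T‖ ^ 2 := by
    refine le_of_forall_pow_succ_le_mul_pow (C := C) (by positivity) fun n => ?_
    -- Then `N + 1` is a power of two, an exponent at which the norm of a self-adjoint element is
    -- multiplicative.
    refine ⟨2 ^ (n + 1) - 1, ?_, ?_⟩
    · have := Nat.lt_two_pow_self (n := n + 1)
      omega
    · have h3 : 2 ^ (n + 1) - 1 + 1 = 2 ^ (n + 1) := Nat.sub_add_cancel Nat.one_le_two_pow
      have h4 := hbound (2 ^ (n + 1) - 1)
      rw [h3] at h4 ⊢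
      have h5 : ‖u ^ 2 ^ (n + 1)‖ = ‖u‖ ^ 2 ^ (n + 1) :=
        congrArg NNReal.toReal (hu.nnnorm_pow_two_pow (n + 1))
      rwa [h5] at h4
  refine (sq_le_sq₀ (norm_nonneg _) (norm_nonneg _)).1 ?_
  rwa [Unitization.norm_inr, CStarRing.norm_self_mul_star, ← sq] at hfin

theorem exists_onCompacts : ∃ f : Λ.compacts m →L[ℂ] B, ∀ ξ η : Λ.Fib m,
    f ⟨rankOne ξ η, rankOne_mem_compactOps ξ η⟩ = ψ.fib m ξ * star (ψ.fib m η) := by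
  have hs : {T : Λ.Fib m →L[ℂ] Λ.Fib m | ∃ ξ η : Λ.Fib m, T = rankOne ξ η}
      = Set.range fun x : Λ.Fib m × Λ.Fib m => rankOne x.1 x.2 :=
    Set.ext fun T => ⟨fun ⟨ξ, η, h⟩ => ⟨(ξ, η), h.symm⟩, fun ⟨x, h⟩ => ⟨x.1, x.2, h.symm⟩⟩
  obtain ⟨f, hf⟩ := exists_extend_topologicalClosure_span hs
    (g := fun x => ψ.fib m x.1 * star (ψ.fib m x.2)) fun c =>
      ψ.norm_sum_fib_mul_star_le c.support c
  exact ⟨f, fun ξ η => hf (ξ, η) _⟩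

theorem onCompacts_rankOne (ξ η : Λ.Fib m) :
    ψ.onCompacts m ⟨rankOne ξ η, rankOne_mem_compactOps ξ η⟩
      = ψ.fib m ξ * star (ψ.fib m η) := by
  rw [onCompacts, dif_pos ψ.exists_onCompacts]
  exact ψ.exists_onCompacts.choose_spec ξ η

theorem onCompacts_congr {S T : Λ.compacts m} (h : (S : Λ.Fib m →L[ℂ] Λ.Fib m) = T) :
    ψ.onCompacts m S = ψ.onCompacts m T := congrArg _ (Subtype.ext h)

theorem onCompacts_mul_fib (S : Λ.compacts m) (ζ : Λ.Fib m) :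
    ψ.onCompacts m S * ψ.fib m ζ = ψ.fib m (S.1 ζ) := by
  refine compacts_induction (P := fun S => ψ.onCompacts m S * ψ.fib m ζ = ψ.fib m (S.1 ζ))
    ?_ ?_ ?_ ?_ ?_ S
  · refine isClosed_eq (by fun_prop) ?_
    exact (ψ.fibL m).continuous.comp (by fun_prop)
  · simp
  · intro S T hS hT
    rw [map_add, add_mul, hS, hT, ← map_add]; rfl
  · intro c T hT
    rw [map_smul, smul_mul_assoc, hT, ← map_smul]; rfl
  · intro ξ η
    rw [onCompacts_rankOne, fib_mul_star_mul_fib]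

/-- By linearity and continuity `T` may be taken to be `Θ_{ξ,η}`; then `S Θ_{ξ,η} = Θ_{Sξ,η}`, and
`ψ^{(m)}(S) ψ_m(ξ) = ψ_m(Sξ)` finishes. -/
theorem onCompacts_comp (S T : Λ.compacts m) :
    ψ.onCompacts m S * ψ.onCompacts m T
      = ψ.onCompacts m ⟨S.1.comp T.1, comp_mem_compactOps (isRightLinear_of_mem S.2) T.2⟩ := by
  refine compacts_induction (P := fun T => ψ.onCompacts m S * ψ.onCompacts m T
      = ψ.onCompacts m ⟨S.1.comp T.1, comp_mem_compactOps (isRightLinear_of_mem S.2) T.2⟩)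
    ?_ ?_ ?_ ?_ ?_ T
  · refine isClosed_eq (by fun_prop) ((ψ.onCompacts m).continuous.comp ?_)
    exact ((ContinuousLinearMap.compL ℂ _ _ _ S.1).continuous.comp continuous_subtype_val).subtype_mk _
  · rw [map_zero, mul_zero, ← map_zero (ψ.onCompacts m)]
    exact ψ.onCompacts_congr (ContinuousLinearMap.comp_zero _).symm
  · intro T T' h h'
    rw [map_add, mul_add, h, h', ← map_add]
    exact ψ.onCompacts_congr (ContinuousLinearMap.comp_add _ _ _).symm
  · intro c T h
    rw [map_smul, mul_smul_comm, h, ← map_smul]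
    exact ψ.onCompacts_congr (ContinuousLinearMap.comp_smul _ _ _).symm
  · intro ξ η
    rw [onCompacts_rankOne, ← mul_assoc, onCompacts_mul_fib, ← onCompacts_rankOne]
    exact ψ.onCompacts_congr (comp_rankOne (isRightLinear_of_mem S.2) ξ η).symm

theorem fib_mul_of_add_eq {n q : Fin k → ℕ} (h : m + n = q) (ξ : Λ.Fib m) (η : Λ.Fib n) :
    ψ.fib q (Λ.mul h ξ η) = ψ.fib m ξ * ψ.fib n η := by
  subst h
  exact ψ.fib_mul m n ξ η

end ToeplitzRep

end TopologicalKGraph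

/-! ### Pushforward along local homeomorphisms and nondegeneracy of the left action. -/

section LocalHomeomorph

variable {X Y F : Type*} [TopologicalSpace X] [TopologicalSpace Y] [T2Space Y]
  [NormedAddCommGroup F]

/-- Pushing forward a compactly supported function along a local homeomorphism that is injective on
a neighbourhood of the support. -/
theorem IsLocalHomeomorph.exists_pushforward {θ : X → Y} (hθ : IsLocalHomeomorph θ) {U : Set X}
    (hU : IsOpen U) (hinj : Set.InjOn θ U) {g : X → F} (hg : Continuous g)
    (hc : HasCompactSupport g) (hgU : tsupport g ⊆ U) :
    ∃ h : C₀(Y, F), ∀ y, HasSum (fun x : {x // θ x = y} => g x) (h y) := by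
  classical
  let h : Y → F := fun y => if hy : ∃ x ∈ U, θ x = y then g hy.choose else 0
  have h1 : ∀ x ∈ U, h (θ x) = g x := fun x hx => by
    have hy : ∃ x' ∈ U, θ x' = θ x := ⟨x, hx, rfl⟩
    simp only [h, dif_pos hy]
    rw [hinj hy.choose_spec.1 hx hy.choose_spec.2]
  have h2 : ∀ y, y ∉ θ '' tsupport g → h y = 0 := fun y hy => by
    by_cases hy' : ∃ x ∈ U, θ x = y
    · obtain ⟨x, hx, rfl⟩ := hy'
      rw [h1 x hx]
      exact image_eq_zero_of_notMem_tsupport fun hx' => hy ⟨x, hx', rfl⟩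
    · simp only [h, dif_neg hy']
  have hK : IsCompact (θ '' tsupport g) := hc.isCompact.image hθ.continuous
  have hcont : Continuous h := by
    refine continuous_iff_continuousAt.2 fun y => ?_
    -- Near a point of the image of the support, `h` is `g` composed with a local section of `θ`;
    -- the complement of this compact image is open and `h` vanishes on it.
    by_cases hy : y ∈ θ '' tsupport g
    · obtain ⟨x, hx, rfl⟩ := hy
      obtain ⟨φ, hxφ, rfl⟩ := hθ x
      have ht : φ x ∈ φ.target := φ.map_source hxφ
      have hσ : ContinuousAt φ.symm (φ x) := φ.symm.continuousAt ht
      have hev : ∀ᶠ y in 𝓝 (φ x), g (φ.symm y) = h y := by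
        have h3 : U ∈ 𝓝 (φ.symm (φ x)) := by
          rw [φ.left_inv hxφ]; exact hU.mem_nhds (hgU hx)
        filter_upwards [φ.open_target.mem_nhds ht, hσ.preimage_mem_nhds h3] with y hy hyU
        rw [← h1 _ hyU, φ.right_inv hy]
      exact (hg.continuousAt.comp hσ).congr hev
    · refine continuousAt_const.congr (f := fun _ => (0 : F)) ?_
      filter_upwards [hK.isClosed.isOpen_compl.mem_nhds hy] with y' hy'
      exact (h2 y' hy').symm
  have hsupp : HasCompactSupport h := HasCompactSupport.intro hK fun {y} => h2 y
  refine ⟨⟨⟨h, hcont⟩, hsupp.is_zero_at_infty⟩, fun y => ?_⟩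
  change HasSum _ (h y)
  have hzero : ∀ x, x ∉ U → g x = 0 := fun x hx =>
    image_eq_zero_of_notMem_tsupport fun h => hx (hgU h)
  by_cases hy : ∃ x ∈ U, θ x = y
  · obtain ⟨x, hx, rfl⟩ := hy
    rw [h1 x hx]
    refine hasSum_single (⟨x, rfl⟩ : {x' // θ x' = θ x}) fun x' hx' => hzero _ fun hU' => hx' ?_
    exact Subtype.ext (hinj hU' hx x'.2)
  · have h3 : h y = 0 := by simp only [h, dif_neg hy]
    rw [h3]
    have h4 : (fun x : {x // θ x = y} => g x) = fun _ => 0 :=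
      funext fun x => hzero _ fun hU' => hy ⟨x, hU', x.2⟩
    rw [h4]
    exact hasSum_zero

end LocalHomeomorph

namespace TopGraph.Corr

variable {V E : Type*} [TopologicalSpace V] [TopologicalSpace E] {G : TopGraph V E} [T2Space E]

theorem hasSum_sub_leftAct (χ : C₀(V, ℂ)) (ξ : G.Corr) (v : V) :
    HasSum (fun e : {e : E // G.s e = v} => ‖1 - χ (G.r e)‖ ^ 2 * ‖ξ e‖ ^ 2)
      (ip (ξ - leftAct χ ξ) (ξ - leftAct χ ξ) v).re :=
  hasSum_of_eq (hasSum_ip_self (ξ - leftAct χ ξ) v) (fun e => by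
    rw [sub_apply, leftAct_apply, ← mul_pow, ← norm_mul]; ring_nf) rfl

/-- `X` is nondegenerate for the left action. -/
theorem exists_norm_sub_leftAct_le [LocallyCompactSpace V] [T2Space V] (ξ : G.Corr) {ε : ℝ}
    (hε : 0 < ε) : ∃ χ : C₀(V, ℂ), ‖ξ - leftAct χ ξ‖ ≤ ε := by
  classical
  have hε2 : 0 < ε ^ 2 := by positivity
  have hev := (ip ξ ξ).zero_at_infty'.norm.eventually (gt_mem_nhds (by simpa using hε2))
  obtain ⟨K, hK, hKf⟩ := mem_cocompact.1 hev
  -- Finitely many edges over `v` carry all but `ε²` of `⟨ξ, ξ⟩(v)`; take `χ = 1` on their ranges.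
  -- The strict bound persists near `v`, so finitely many such `χ` serve the whole of `K`.
  have hloc : ∀ v : V, ∃ χ : C₀(V, ℂ), HasCompactSupport χ ∧
      (ip (ξ - leftAct χ ξ) (ξ - leftAct χ ξ) v).re < ε ^ 2 := by
    intro v
    obtain ⟨F, hF⟩ := ((hasSum_ip_self ξ v).eventually
      (lt_mem_nhds (sub_lt_self (ip ξ ξ v).re hε2))).exists
    obtain ⟨χ, f, hχ, hf, h1, hc, -⟩ := exists_czero_bump
      (K := (fun e : {e : E // G.s e = v} => G.r e) '' F) (F.finite_toSet.image _).isCompact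
      isOpen_univ (Set.subset_univ _)
    refine ⟨χ, hc, ?_⟩
    have hle : ∀ w, ‖1 - χ w‖ ≤ 1 := fun w => by
      rw [hχ, ← Complex.ofReal_one, ← Complex.ofReal_sub, Complex.norm_real, Real.norm_eq_abs,
        abs_le]
      constructor <;> linarith [(hf w).1, (hf w).2]
    have hs := (hasSum_ip_self ξ v).sub (hasSum_sub_leftAct χ ξ v)
    have hF' := sum_le_hasSum F (fun e _ => by
      rw [sub_nonneg]
      exact mul_le_of_le_one_left (by positivity) (pow_le_one₀ (norm_nonneg _) (hle _))) hs
    have hF2 : ∑ e ∈ F, (‖ξ e‖ ^ 2 - ‖1 - χ (G.r e)‖ ^ 2 * ‖ξ e‖ ^ 2) = ∑ e ∈ F, ‖ξ e‖ ^ 2 :=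
      Finset.sum_congr rfl fun e he => by rw [h1 _ ⟨e, he, rfl⟩]; simp
    rw [hF2] at hF'
    linarith
  choose χ hχc hχ using hloc
  obtain ⟨t, ht⟩ := hK.elim_finite_subcover
    (fun v => {w | (ip (ξ - leftAct (χ v) ξ) (ξ - leftAct (χ v) ξ) w).re < ε ^ 2})
    (fun v => isOpen_lt (Complex.continuous_re.comp (map_continuous _)) continuous_const)
    fun v _ => Set.mem_iUnion.2 ⟨v, hχ v⟩
  -- As `ρ` is `1` on the supports of all the chosen `χ v`, one has `|1 - ρ| ≤ |1 - χ v|`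
  -- everywhere, so `ρ` inherits each local estimate.
  obtain ⟨ρ, f, hρ, hf, h1, -, -⟩ := exists_czero_bump
    (t.isCompact_biUnion fun v _ => (hχc v).isCompact) isOpen_univ (Set.subset_univ _)
  have hle : ∀ w, ‖1 - ρ w‖ ≤ 1 := fun w => by
    rw [hρ, ← Complex.ofReal_one, ← Complex.ofReal_sub, Complex.norm_real, Real.norm_eq_abs,
      abs_le]
    constructor <;> linarith [(hf w).1, (hf w).2]
  refine ⟨ρ, norm_le_of_re_ip_self_le hε.le fun w => ?_⟩
  by_cases hw : w ∈ K
  · obtain ⟨v, hv, hvw⟩ := Set.mem_iUnion₂.1 (ht hw)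
    refine le_trans ?_ (le_of_lt hvw)
    refine hasSum_le (fun e => ?_) (hasSum_sub_leftAct ρ ξ w) (hasSum_sub_leftAct (χ v) ξ w)
    refine mul_le_mul_of_nonneg_right (pow_le_pow_left₀ (norm_nonneg _) ?_ 2) (by positivity)
    by_cases he : G.r e ∈ tsupport (χ v)
    · rw [h1 _ (Set.mem_iUnion₂.2 ⟨v, hv, he⟩)]; simp
    · rw [image_eq_zero_of_notMem_tsupport he, sub_zero, norm_one]; exact hle _
  · have h2 : ‖ip ξ ξ w‖ < ε ^ 2 := hKf hw
    rw [norm_ip_self_apply] at h2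
    refine le_trans ?_ h2.le
    refine hasSum_le (fun e => ?_) (hasSum_sub_leftAct ρ ξ w) (hasSum_ip_self ξ w)
    exact mul_le_of_le_one_left (by positivity) (pow_le_one₀ (norm_nonneg _) (hle _))

end TopGraph.Corr

/-! ### Local functions and the fibres of the correspondence of a dynamical system. -/

namespace TopDynSystem

open TopGraph TopGraph.Corr TopologicalKGraph

variable {k : ℕ} {Ω : Type*} [TopologicalSpace Ω] (D : TopDynSystem k Ω)

/-- The path of degree `m` with range `x`. -/
def path (m : Fin k → ℕ) (x : Ω) : D.kGraph.Path m := ⟨(m, x), rfl⟩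

theorem path_range {m : Fin k → ℕ} (μ : D.kGraph.Path m) : D.path m ((D.kGraph.graph m).r μ) = μ := by
  obtain ⟨⟨m', x⟩, h⟩ := μ
  have h' : m' = m := h
  subst h'
  rfl

@[simp] theorem range_path (m : Fin k → ℕ) (x : Ω) : (D.kGraph.graph m).r (D.path m x) = x := rfl

theorem source_eq {m : Fin k → ℕ} (μ : D.kGraph.Path m) :
    (D.kGraph.graph m).s μ = D.theta m ((D.kGraph.graph m).r μ) := by
  rw [← D.path_range μ]; rfl

theorem range_injective (m : Fin k → ℕ) : Function.Injective (D.kGraph.graph m).r := fun μ ν h => by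
  rw [← D.path_range μ, h, D.path_range]

theorem continuous_path (m : Fin k → ℕ) : Continuous (D.path m) :=
  Continuous.subtype_mk (by fun_prop) _

section HeadTail

variable {m n q : Fin k → ℕ} (h : m + n = q)

theorem head_path (x : Ω) : D.kGraph.head h (D.path q x) = D.path m x :=
  D.kGraph.head_eq h _ _ (D.path n (D.theta m x)) rfl (by subst h; rfl)

theorem tail_path (x : Ω) : D.kGraph.tail h (D.path q x) = D.path n (D.theta m x) :=
  D.kGraph.tail_eq h _ (D.path m x) _ rfl (by subst h; rfl)

end HeadTail

/-- The fibre of the source map is the fibre of `Θ_m`. -/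
def fiberEquivTheta (m : Fin k → ℕ) (v : Ω) :
    {μ : D.kGraph.Path m // (D.kGraph.graph m).s μ = v} ≃ {x : Ω // D.theta m x = v} where
  toFun μ := ⟨(D.kGraph.graph m).r μ.1, (D.source_eq μ.1).symm.trans μ.2⟩
  invFun x := ⟨D.path m x.1, x.2⟩
  left_inv μ := Subtype.ext (D.path_range μ.1)
  right_inv _ := rfl

/-- `a` is supported in a compact subset of an open set on which `Θ_m` is injective. -/
def IsLocal (m : Fin k → ℕ) (a : C₀(Ω, ℂ)) : Prop :=
  HasCompactSupport a ∧ ∃ U, IsOpen U ∧ Set.InjOn (D.theta m) U ∧ tsupport a ⊆ U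

variable {D}

theorem IsLocal.of_tsupport_subset {m : Fin k → ℕ} {a b : C₀(Ω, ℂ)} (hb : D.IsLocal m b)
    (h : tsupport a ⊆ tsupport b) : D.IsLocal m a :=
  ⟨hb.1.of_isClosed_subset isClosed_closure h, by
    obtain ⟨-, U, hU, hinj, hsub⟩ := hb
    exact ⟨U, hU, hinj, h.trans hsub⟩⟩

variable [T2Space Ω]

/-- Each source fibre meets the support of `a ∘ r` at most once, so the fibre sums of `|a|²` are a
pushforward along `Θ_m` and lie in `C₀(Ω)`. -/
theorem IsLocal.exists_fib {m : Fin k → ℕ} {a : C₀(Ω, ℂ)} (ha : D.IsLocal m a) :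
    ∃ ξ : D.kGraph.Fib m, ∀ μ, ξ μ = a ((D.kGraph.graph m).r μ) := by
  obtain ⟨hc, U, hU, hinj, hsub⟩ := ha
  have h0 : tsupport (fun x => ‖a x‖ ^ 2) ⊆ tsupport a :=
    tsupport_comp_subset (g := fun z : ℂ => ‖z‖ ^ 2) (by simp) a
  obtain ⟨f, hf⟩ := (D.isLocalHomeomorph_theta m).exists_pushforward hU hinj
    (g := fun x => ‖a x‖ ^ 2) (by fun_prop) (hc.of_isClosed_subset isClosed_closure h0)
    (h0.trans hsub)
  exact ⟨Corr.mk (fun μ => a ((D.kGraph.graph m).r μ))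
    (a.continuous.comp (D.kGraph.graph m).continuous_r)
    ⟨f, fun v => hasSum_of_eq ((D.fiberEquivTheta m v).hasSum_iff.2 (hf v)) (fun _ => rfl) rfl⟩,
    fun _ => rfl⟩

/-- The inner product with an element supported where the source map is injective. -/
theorem ip_source_of_injOn {m : Fin k → ℕ} {U : Set Ω} (hinj : Set.InjOn (D.theta m) U)
    {ω : D.kGraph.Fib m} (hω : ∀ μ, (D.kGraph.graph m).r μ ∉ U → ω μ = 0)
    (ζ : D.kGraph.Fib m) {μ : D.kGraph.Path m} (hμ : (D.kGraph.graph m).r μ ∈ U) :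
    ip ω ζ ((D.kGraph.graph m).s μ) = conj (ω μ) * ζ μ := by
  refine (hasSum_ip ω ζ _).unique (hasSum_single
    (⟨μ, rfl⟩ : {ν // (D.kGraph.graph m).s ν = (D.kGraph.graph m).s μ}) fun ν hν => ?_)
  rw [hω ν.1 fun h => hν ?_, map_zero, zero_mul]
  refine Subtype.ext (D.range_injective m (hinj h hμ ?_))
  rw [← D.source_eq, ← D.source_eq, ν.2]

variable [LocallyCompactSpace Ω]

/-- A local bump function that is `1` on the support of `a`. -/
theorem IsLocal.exists_bump {m : Fin k → ℕ} {a : C₀(Ω, ℂ)} (ha : D.IsLocal m a) :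
    ∃ b : C₀(Ω, ℂ), (∀ x, a x * conj (b x) = a x) ∧ (∀ x ∈ tsupport a, b x = 1) ∧
      HasCompactSupport b ∧ ∃ U, IsOpen U ∧ Set.InjOn (D.theta m) U ∧ tsupport a ⊆ U ∧
        tsupport b ⊆ U := by
  obtain ⟨hc, U, hU, hinj, hsub⟩ := ha
  obtain ⟨b, -, -, -, h1, hbc, hbU⟩ := exists_czero_bump hc.isCompact hU hsub
  refine ⟨b, fun x => ?_, h1, hbc, U, hU, hinj, hsub, hbU⟩
  by_cases hx : x ∈ tsupport a
  · simp [h1 x hx]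
  · simp [image_eq_zero_of_notMem_tsupport hx]

/-- For local `a`, the left action of `a` is a rank one operator. -/
theorem IsLocal.exists_phi_eq_rankOne {m : Fin k → ℕ} {a : C₀(Ω, ℂ)} (ha : D.IsLocal m a) :
    ∃ (b : C₀(Ω, ℂ)) (ζ ω : D.kGraph.Fib m), a * star b = a ∧
      (∀ μ, ζ μ = a ((D.kGraph.graph m).r μ)) ∧ (∀ μ, ω μ = b ((D.kGraph.graph m).r μ)) ∧
      D.kGraph.phi m a = rankOne ζ ω := by
  obtain ⟨b, hab, -, hbc, U, hU, hinj, haU, hbU⟩ := ha.exists_bump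
  obtain ⟨ζ, hζ⟩ := ha.exists_fib
  obtain ⟨ω, hω⟩ := IsLocal.exists_fib (D := D) (m := m) ⟨hbc, U, hU, hinj, hbU⟩
  refine ⟨b, ζ, ω, ZeroAtInftyContinuousMap.ext hab, hζ, hω, ?_⟩
  ext ξ μ
  rw [leftAct_apply, rankOne_apply_apply, hζ]
  -- For range in `U` the sum defining `⟨ω, ξ⟩` has a single term, and its factor `conj b` is
  -- absorbed by `a`. Outside `U` both sides vanish with `a`.
  by_cases hμ : (D.kGraph.graph m).r μ ∈ U
  · rw [ip_source_of_injOn hinj (fun ν hν => by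
      rw [hω]; exact image_eq_zero_of_notMem_tsupport fun h => hν (hbU h)) ξ hμ, hω,
      ← mul_assoc, hab]
  · rw [image_eq_zero_of_notMem_tsupport fun h => hμ (haU h), zero_mul, zero_mul]

/-- The local functions span a dense subspace of `C₀(Ω)`. -/
theorem dense_span_isLocal (m : Fin k → ℕ) :
    (Submodule.span ℂ {a | D.IsLocal m a}).topologicalClosure = ⊤ := by
  refine Submodule.eq_top_iff'.2 fun f => ?_
  refine Metric.mem_closure_iff.2 fun ε hε => ?_
  obtain ⟨χ, hc, -, hχ⟩ := exists_czero_approx_unit f (half_pos hε)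
  refine ⟨χ * f, ?_, ?_⟩
  -- A partition of unity subordinate to finitely many sets of injectivity splits the compactly
  -- supported `χ f` into local functions.
  · have hloc : ∀ x : Ω, ∃ U, IsOpen U ∧ x ∈ U ∧ Set.InjOn (D.theta m) U := fun x => by
      obtain ⟨φ, hx, hφ⟩ := D.isLocalHomeomorph_theta m x
      exact ⟨φ.source, φ.open_source, hx, hφ ▸ φ.injOn⟩
    choose U hU hxU hinj using hloc
    obtain ⟨t, ht⟩ := hc.isCompact.elim_finite_subcover U hU
      fun x _ => Set.mem_iUnion.2 ⟨x, hxU x⟩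
    obtain ⟨ρ, h1, h2, -, h4⟩ := exists_continuous_sum_one_of_isOpen_isCompact
      (s := fun i : Fin t.card => U (t.equivFin.symm i)) (fun i => hU _) hc.isCompact
      fun x hx => by
        obtain ⟨y, hy, hxy⟩ := Set.mem_iUnion₂.1 (ht hx)
        exact Set.mem_iUnion.2 ⟨t.equivFin ⟨y, hy⟩, by simpa using hxy⟩
    have hsub : ∀ i, tsupport (fun x => (ρ i x : ℂ)) ⊆ tsupport (ρ i) := fun i =>
      tsupport_comp_subset (g := fun x : ℝ => (x : ℂ)) Complex.ofReal_zero (ρ i)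
    have hcs : ∀ i, HasCompactSupport (fun x => (ρ i x : ℂ)) := fun i =>
      (h4 i).of_isClosed_subset isClosed_closure (hsub i)
    let P : Fin t.card → C₀(Ω, ℂ) := fun i =>
      ⟨⟨fun x => (ρ i x : ℂ), by fun_prop⟩, (hcs i).is_zero_at_infty⟩
    have hsum : χ * f = ∑ i, P i * (χ * f) := by
      ext x
      have h5 : (∑ i, P i * (χ * f)) x = ∑ i, (ρ i x : ℂ) * (χ x * f x) :=
        map_sum (⟨⟨fun g : C₀(Ω, ℂ) => g x, rfl⟩, fun _ _ => rfl⟩ : C₀(Ω, ℂ) →+ ℂ) _ _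
      rw [h5, ← Finset.sum_mul]
      change χ x * f x = _
      by_cases hx : x ∈ tsupport χ
      · have h6 : ∑ i, ρ i x = 1 := by simpa using h2 hx
        rw [← Complex.ofReal_sum, h6]; simp
      · simp [image_eq_zero_of_notMem_tsupport hx]
    rw [hsum]
    refine Submodule.sum_mem _ fun i _ => Submodule.subset_span ?_
    exact IsLocal.of_tsupport_subset (b := P i)
      ⟨hcs i, _, hU _, hinj _, (hsub i).trans (h1 i)⟩ (tsupport_mul_subset_left)
  · rw [dist_eq_norm, ← ZeroAtInftyContinuousMap.norm_toBCF_eq_norm]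
    refine lt_of_le_of_lt ((BoundedContinuousFunction.norm_le (half_pos hε).le).2 fun x => ?_)
      (half_lt_self hε)
    change ‖f x - χ x * f x‖ ≤ _
    refine le_trans (le_of_eq ?_) (hχ x)
    rw [← norm_mul]; ring_nf

/-- For `a` local for `Θ_q` and `ζ ∈ X_q`, `q = m + n`, the function `a ζ` is a product. -/
theorem IsLocal.exists_mul_eq_phi {m n q : Fin k → ℕ} (h : m + n = q) {a : C₀(Ω, ℂ)}
    (ha : D.IsLocal q a) (ζ : D.kGraph.Fib q) :
    ∃ (ξ : D.kGraph.Fib m) (η : D.kGraph.Fib n), D.kGraph.mul h ξ η = D.kGraph.phi q a ζ := by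
  obtain ⟨b, -, hb1, hbc, U, hU, hinj, haU, hbU⟩ := ha.exists_bump
  have hth : ∀ x, D.theta q x = D.theta n (D.theta m x) := fun x => by rw [← h, D.theta_add]
  have hinjm : Set.InjOn (D.theta m) U := fun x hx y hy hxy => hinj hx hy (by rw [hth, hth, hxy])
  -- The factors are `ξ = a ∘ r` and `η = ⟨ω, ζ'⟩ ∘ r`, where `ω = b ∘ r` and `ζ'` is `b ζ` moved to
  -- degree `m`. Thus `⟨ω, ζ'⟩` is the pushforward of `|b|² ζ` along `Θ_m`; its support lies in
  -- `Θ_m(U)`, and the present injectivity places `η` in `X_n`. On the support of `a` one has `b =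
  -- 1`, which leaves `a ζ`.
  have hinjn : Set.InjOn (D.theta n) (D.theta m '' U) := by
    rintro _ ⟨x, hx, rfl⟩ _ ⟨y, hy, rfl⟩ hxy
    rw [hinj hx hy (by rw [hth, hth, hxy])]
  have hbl : D.IsLocal m b := ⟨hbc, U, hU, hinjm, hbU⟩
  obtain ⟨ξ, hξ⟩ := IsLocal.exists_fib (D := D) (m := m) ⟨ha.1, U, hU, hinjm, haU⟩
  obtain ⟨ω, hω⟩ := hbl.exists_fib
  have hβs : tsupport (fun x => b x * ζ (D.path q x)) ⊆ tsupport b := tsupport_mul_subset_left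
  have hβc : HasCompactSupport fun x => b x * ζ (D.path q x) :=
    hbc.of_isClosed_subset isClosed_closure hβs
  let β : C₀(Ω, ℂ) := ⟨⟨fun x => b x * ζ (D.path q x),
    b.continuous.mul (ζ.continuous_coe.comp (D.continuous_path q))⟩,
    hβc.is_zero_at_infty⟩
  obtain ⟨ζ', hζ'⟩ := (hbl.of_tsupport_subset (a := β) hβs).exists_fib
  have hω0 : ∀ μ, (D.kGraph.graph m).r μ ∉ U → ω μ = 0 := fun ν hν => by
    rw [hω]; exact image_eq_zero_of_notMem_tsupport fun h => hν (hbU h)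
  have hK : IsCompact (D.theta m '' tsupport b) :=
    hbc.isCompact.image (D.isLocalHomeomorph_theta m).continuous
  have hzero : ∀ y ∉ D.theta m '' tsupport b, ip ω ζ' y = 0 := fun y hy => by
    refine (hasSum_ip ω ζ' y).unique ?_
    have h1 : (fun μ : {μ // (D.kGraph.graph m).s μ = y} => conj (ω μ) * ζ' μ) = fun _ => 0 :=
      funext fun μ => by
        have h2 : b ((D.kGraph.graph m).r μ.1) = 0 := image_eq_zero_of_notMem_tsupport fun hμ =>
          hy ⟨_, hμ, (D.source_eq μ.1).symm.trans μ.2⟩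
        rw [hω, h2, map_zero, zero_mul]
    rw [h1]
    exact hasSum_zero
  have hsupp : tsupport (ip ω ζ') ⊆ D.theta m '' tsupport b :=
    closure_minimal (fun y hy => by_contra fun h => hy (hzero y h)) hK.isClosed
  obtain ⟨η, hη⟩ := IsLocal.exists_fib (D := D) (m := n) (a := ip ω ζ')
    ⟨hK.of_isClosed_subset isClosed_closure hsupp, _,
      (D.isLocalHomeomorph_theta m).isOpenMap U hU, hinjn,
      hsupp.trans (Set.image_mono hbU)⟩
  refine ⟨ξ, η, ?_⟩
  ext μ
  obtain ⟨x, rfl⟩ : ∃ x, D.path q x = μ := ⟨_, D.path_range μ⟩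
  rw [mul_apply, D.head_path, D.tail_path, hξ, hη, leftAct_apply, range_path, range_path,
    range_path]
  by_cases hx : x ∈ tsupport a
  · have h1 : ip ω ζ' (D.theta m x) = conj (ω (D.path m x)) * ζ' (D.path m x) :=
      ip_source_of_injOn hinjm hω0 ζ' (μ := D.path m x) (haU hx)
    rw [h1, hω, hζ', range_path]
    change a x * (conj (b x) * (b x * ζ (D.path q x))) = _
    simp [hb1 x hx]
  · simp [image_eq_zero_of_notMem_tsupport hx]

/-- For local `a` the vector `φ(a)ζ` is a single product. Density of local functions puts every
`φ(a)ζ` into the closed span, and left nondegeneracy then gives `ζ`. -/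
theorem productsDense {m n q : Fin k → ℕ} (h : m + n = q) : D.kGraph.ProductsDense h := by
  refine Submodule.eq_top_iff'.2 fun ζ => ?_
  set W := (Submodule.span ℂ (Set.range fun x : D.kGraph.Fib m × D.kGraph.Fib n =>
    D.kGraph.mul h x.1 x.2)).topologicalClosure with hW
  have hWc : IsClosed (W : Set (D.kGraph.Fib q)) := Submodule.isClosed_topologicalClosure _
  have h1 : ∀ a, D.kGraph.phi q a ζ ∈ W := fun a => by
    let R : C₀(Ω, ℂ) →L[ℂ] D.kGraph.Fib q := (leftActL (D.kGraph.graph q)).flip ζ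
    have hle : (Submodule.span ℂ {a | D.IsLocal q a}).topologicalClosure
        ≤ W.comap (R : C₀(Ω, ℂ) →ₗ[ℂ] D.kGraph.Fib q) := by
      refine Submodule.topologicalClosure_minimal _ (Submodule.span_le.2 fun a ha => ?_)
        (hWc.preimage R.continuous)
      obtain ⟨ξ, η, hξη⟩ := IsLocal.exists_mul_eq_phi h ha ζ
      refine Submodule.le_topologicalClosure _ (Submodule.subset_span ⟨(ξ, η), hξη⟩)
    rw [dense_span_isLocal] at hle
    exact hle (Submodule.mem_top (x := a))
  refine hWc.closure_subset_iff.2 subset_rfl (Metric.mem_closure_iff.2 fun ε hε => ?_)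
  obtain ⟨χ, hχ⟩ := exists_norm_sub_leftAct_le ζ (half_pos hε)
  exact ⟨_, h1 χ, by rw [dist_eq_norm]; exact lt_of_le_of_lt hχ (half_lt_self hε)⟩

/-- Every `x` is the range of a path of degree `m`, and a bump on a set where `Θ_m` is injective
gives an element of `X_m` with value `1` on that path. -/
theorem phi_injective (m : Fin k → ℕ) : Function.Injective (D.kGraph.phi m) := fun a b hab => by
  ext x
  obtain ⟨φ, hx, hφ⟩ := D.isLocalHomeomorph_theta m x
  obtain ⟨χ, -, -, -, h1, hc, hU⟩ := exists_czero_bump (isCompact_singleton (x := x))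
    φ.open_source (Set.singleton_subset_iff.2 hx)
  obtain ⟨ξ, hξ⟩ := IsLocal.exists_fib (D := D) (m := m) (a := χ)
    ⟨hc, φ.source, φ.open_source, hφ ▸ φ.injOn, hU⟩
  have h2 := DFunLike.congr_fun (congrArg (fun S => S ξ) hab) (D.path m x)
  simpa [hξ, h1 x rfl] using h2

end TopDynSystem

/-! ### Compact alignment, the spaces `X̃_q`, and the covariance conditions. -/

namespace TopDynSystem

open TopGraph TopGraph.Corr TopologicalKGraph

variable {k : ℕ} {Ω : Type*} [TopologicalSpace Ω] {D : TopDynSystem k Ω} [LocallyCompactSpace Ω]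
  [T2Space Ω]

/-- A closed submodule of `C₀(Ω)` containing the local functions is everything. -/
theorem mem_of_isLocal {m : Fin k → ℕ} {N : Submodule ℂ C₀(Ω, ℂ)}
    (hN : IsClosed (N : Set C₀(Ω, ℂ))) (h : ∀ a, D.IsLocal m a → a ∈ N) (a : C₀(Ω, ℂ)) : a ∈ N := by
  have hle : (Submodule.span ℂ {a | D.IsLocal m a}).topologicalClosure ≤ N :=
    Submodule.topologicalClosure_minimal _ (Submodule.span_le.2 h) hN
  rw [dense_span_isLocal] at hle
  exact hle Submodule.mem_top

/-- The left action is by generalized compact operators. -/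
theorem phi_mem_compacts (m : Fin k → ℕ) (a : C₀(Ω, ℂ)) :
    D.kGraph.phi m a ∈ D.kGraph.compacts m := by
  refine mem_of_isLocal (D := D) (m := m) (N := (D.kGraph.compacts m).comap
    (leftActL (D.kGraph.graph m) : C₀(Ω, ℂ) →ₗ[ℂ] _)) ?_ (fun a ha => ?_) a
  · exact (Submodule.isClosed_topologicalClosure _).preimage (leftActL _).continuous
  · obtain ⟨_, ζ, ω, -, -, -, h⟩ := ha.exists_phi_eq_rankOne
    change D.kGraph.phi m a ∈ D.kGraph.compacts m
    rw [h]
    exact rankOne_mem_compactOps ζ ω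

/-- A path and its initial segment have the same range, so multiplication by `a ∘ r` on a product
affects only the first factor. -/
theorem iota_phi {p q : Fin k → ℕ} (hpq : p ≤ q) (a : C₀(Ω, ℂ)) :
    D.kGraph.iota p q (D.kGraph.phi p a) = D.kGraph.phi q a := by
  refine iota_eq hpq (productsDense _) fun ξ η => ?_
  ext μ
  obtain ⟨x, rfl⟩ : ∃ x, D.path q x = μ := ⟨_, D.path_range μ⟩
  simp [head_path, mul_assoc]

/-- By continuity of `ι_p^q` it suffices to treat `Θ_{ξ·a,η}` with `a` local for `Θ_{q-p}`; then
`φ_{q-p}(a)` has rank one, and so does the image. -/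
theorem iota_mem_compacts {p q : Fin k → ℕ} (hpq : p ≤ q) (T : D.kGraph.compacts p) :
    D.kGraph.iota p q T ∈ D.kGraph.compacts q := by
  refine compacts_induction_smul (dense_span_isLocal (D := D) (q - p))
    (P := fun T => iotaL hpq (productsDense _) T ∈ D.kGraph.compacts q) ?_ ?_ ?_ ?_ ?_ T
  · exact (Submodule.isClosed_topologicalClosure _).preimage (iotaL _ _).continuous
  · rw [map_zero]; exact zero_mem _
  · intro S T hS hT
    rw [map_add]; exact add_mem hS hT
  · intro c T hT
    rw [map_smul]; exact Submodule.smul_mem _ c hT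
  · intro a ha ξ η
    obtain ⟨_, ζ, ω, -, -, -, h⟩ := IsLocal.exists_phi_eq_rankOne ha
    rw [iotaL_apply]
    change D.kGraph.iota p q (rankOne (a • ξ) η) ∈ _
    rw [iota_rankOne hpq (productsDense _) ξ η h]
    exact rankOne_mem_compactOps _ _

/-- `ι_p^q` as a continuous linear map between the generalized compact operators. -/
noncomputable def iotaCompactsL {p q : Fin k → ℕ} (hpq : p ≤ q) :
    D.kGraph.compacts p →L[ℂ] D.kGraph.compacts q :=
  (iotaL hpq (productsDense _)).codRestrict (D.kGraph.compacts q) (iota_mem_compacts hpq)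

theorem isRightLinear_iota {p q : Fin k → ℕ} (hpq : p ≤ q) (T : D.kGraph.compacts p) :
    IsRightLinear (D.kGraph.iota p q T) := isRightLinear_of_mem (iota_mem_compacts hpq T)

theorem corrCompactlyAligned : D.kGraph.CorrCompactlyAligned := fun _ _ S hS T hT =>
  comp_mem_compactOps (isRightLinear_iota le_sup_left ⟨S, hS⟩)
    (iota_mem_compacts le_sup_right ⟨T, hT⟩)

/-- `X_q` is the component at `q` of `X̃_q`. -/
theorem exists_tildeFib {q : Fin k → ℕ} (ζ : D.kGraph.Fib q) :
    ∃ ξ : D.kGraph.tildeFib q, ξ.1 ⟨q, Set.mem_Iic.2 le_rfl⟩ = ζ := by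
  classical
  refine ⟨⟨Pi.single ⟨q, Set.mem_Iic.2 le_rfl⟩ ζ, fun p _ => ?_⟩, Pi.single_eq_same _ _⟩
  by_cases hp : p = ⟨q, Set.mem_Iic.2 le_rfl⟩
  · subst hp
    rw [Pi.single_eq_same]
    have h1 : {x : D.kGraph.Fib q | ∃ (ξ : D.kGraph.Fib q) (a : C₀(Ω, ℂ)), x = a • ξ}
        ⊆ {x | ∃ ξ : D.kGraph.Fib q, ∃ a ∈ D.kGraph.idealI (q - q), x = a • ξ} := by
      rintro _ ⟨ξ, a, rfl⟩
      -- `I_0` is all of `C₀(Ω)`: no `r ≠ 0` lies below `q - q = 0`.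
      refine ⟨ξ, a, fun r hr hr' => absurd (le_antisymm ?_ (zero_le)) hr, rfl⟩
      rwa [tsub_self] at hr'
    have h2 := Submodule.topologicalClosure_mono (Submodule.span_mono (R := ℂ) h1)
    rw [dense_span_right_smul] at h2
    exact h2 (Submodule.mem_top (x := ζ))
  · rw [Pi.single_eq_of_ne hp]
    exact zero_mem _

/-- The components of `X̃_q` below `q` vanish, because the left actions are faithful. -/
theorem tildeFib_apply_eq_zero {q : Fin k → ℕ} (ξ : D.kGraph.tildeFib q) (p : Set.Iic q)
    (hp : p.1 ≠ q) : ξ.1 p = 0 := by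
  have hne : q - p.1 ≠ 0 := fun h => hp (le_antisymm p.2 (tsub_eq_zero_iff_le.1 h))
  have h1 : ξ.1 p ∈ D.kGraph.fibMulIdeal p.1 (D.kGraph.idealI (q - p.1)) := ξ.2 p trivial
  have h2 : D.kGraph.fibMulIdeal p.1 (D.kGraph.idealI (q - p.1)) ≤ ⊥ := by
    refine Submodule.topologicalClosure_minimal _ (Submodule.span_le.2 ?_) isClosed_singleton
    rintro _ ⟨ζ, a, ha, rfl⟩
    have h3 : a = 0 := phi_injective (D := D) (q - p.1) (by
      rw [ha _ hne le_rfl]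
      exact (map_zero (leftActL (D.kGraph.graph (q - p.1)))).symm)
    rw [h3]
    exact map_zero (rightActL ζ)
  exact (Submodule.mem_bot ℂ).1 (h2 h1)

theorem tildePhi_injective (q : Fin k → ℕ) : Function.Injective (D.kGraph.tildePhi q) :=
  fun a b hab => phi_injective (D := D) q <| ContinuousLinearMap.ext fun ζ => by
    obtain ⟨ξ, hξ⟩ := exists_tildeFib ζ
    rw [← hξ]
    exact congrFun (congrFun hab ξ) ⟨q, Set.mem_Iic.2 le_rfl⟩

variable {B : Type*} [NonUnitalCStarAlgebra B] (ψ : D.kGraph.ToeplitzRep B)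

/-- Under the identification of `X_0` with `C₀(Ω)`, `ψ^{(0)}` is `ψ_e`. -/
theorem onCompacts_phi_zero (a : C₀(Ω, ℂ)) :
    ψ.onCompacts 0 ⟨D.kGraph.phi 0 a, phi_mem_compacts 0 a⟩ = ψ.base a := by
  let R : C₀(Ω, ℂ) →L[ℂ] D.kGraph.compacts 0 :=
    (leftActL (D.kGraph.graph 0)).codRestrict (D.kGraph.compacts 0) (phi_mem_compacts 0)
  refine mem_of_isLocal (D := D) (m := 0) (N := LinearMap.eqLocus
    ((ψ.onCompacts 0).comp R : C₀(Ω, ℂ) →ₗ[ℂ] B) (ψ.baseL : C₀(Ω, ℂ) →ₗ[ℂ] B)) ?_ (fun a ha => ?_) a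
  · exact isClosed_eq ((ψ.onCompacts 0).comp R).continuous ψ.baseL.continuous
  · obtain ⟨b, ζ, ω, hab, hζ, hω, h⟩ := ha.exists_phi_eq_rankOne
    have hζ' : ζ = D.kGraph.unitFib a := Corr.ext hζ
    have hω' : ω = D.kGraph.unitFib b := Corr.ext hω
    change ψ.onCompacts 0 ⟨D.kGraph.phi 0 a, phi_mem_compacts 0 a⟩ = ψ.base a
    rw [ψ.onCompacts_congr (T := ⟨rankOne ζ ω, rankOne_mem_compactOps ζ ω⟩) h,
      ψ.onCompacts_rankOne, hζ', hω', ψ.fib_zero, ψ.fib_zero, ← map_star, ← map_mul, hab]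

variable {ψ}

/-- Cuntz–Pimsner covariance makes the maps `ψ^{(p)}` compatible with `ι_p^q`. -/
theorem onCompacts_iota (hψ : ψ.IsCuntzPimsnerCovariant) {p q : Fin k → ℕ} (hpq : p ≤ q)
    (T : D.kGraph.compacts p) :
    ψ.onCompacts q ⟨D.kGraph.iota p q T, iota_mem_compacts hpq T⟩ = ψ.onCompacts p T := by
  have hext : (ψ.onCompacts q).comp (iotaCompactsL hpq) = ψ.onCompacts p := by
    refine compacts_clm_ext (dense_span_isLocal (D := D) (q - p)) fun a ha ξ η => ?_
    obtain ⟨_, ζ, ω, -, -, -, h⟩ := IsLocal.exists_phi_eq_rankOne ha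
    -- The only use of (CP-K): it applies to every `a`, since `φ` is injective and so the
    -- orthogonality condition is automatic. The element `ψ_0(a)` then appears in the middle of
    -- `ψ_p(ξ)ψ(ζ)ψ(ω)*ψ_p(η)*`.
    have h1 : ψ.fib (q - p) ζ * star (ψ.fib (q - p) ω) = ψ.base a := by
      rw [← hψ (q - p) a (phi_mem_compacts _ a) fun b hb => ?_, ← ψ.onCompacts_rankOne]
      · exact ψ.onCompacts_congr h.symm
      · have hb0 : b = 0 := phi_injective (D := D) (q - p)
          (hb.trans (map_zero (leftActL (D.kGraph.graph (q - p)))).symm)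
        rw [hb0, mul_zero]
    have h2 : ψ.onCompacts q (iotaCompactsL hpq
        ⟨rankOne (a • ξ) η, rankOne_mem_compactOps (a • ξ) η⟩)
          = ψ.fib q (D.kGraph.mul (add_tsub_cancel_of_le hpq) ξ ζ)
            * star (ψ.fib q (D.kGraph.mul (add_tsub_cancel_of_le hpq) η ω)) :=
      (ψ.onCompacts_congr (iota_rankOne hpq (productsDense _) ξ η h)).trans
        (ψ.onCompacts_rankOne _ _)
    have h3 := ψ.onCompacts_rankOne (a • ξ) η
    rw [ψ.fib_right] at h3
    rw [ψ.fib_mul_of_add_eq, ψ.fib_mul_of_add_eq, star_mul] at h2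
    refine h2.trans (Eq.trans ?_ h3.symm)
    rw [← h1]
    simp only [mul_assoc]
  exact DFunLike.congr_fun hext T

/-- Both factors are moved to `X_{p∨q}` by `onCompacts_iota`, where `ψ^{(p∨q)}` is multiplicative.
-/
theorem isNicaCovariant (hψ : ψ.IsCuntzPimsnerCovariant) : ψ.IsNicaCovariant := by
  intro p q S T
  have h1 := onCompacts_iota hψ (le_sup_left : p ≤ p ⊔ q) S
  have h2 := onCompacts_iota hψ (le_sup_right : q ≤ p ⊔ q) T
  have h3 := ψ.onCompacts_comp ⟨_, iota_mem_compacts (le_sup_left : p ≤ p ⊔ q) S⟩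
    ⟨_, iota_mem_compacts (le_sup_right : q ≤ p ⊔ q) T⟩
  rw [h1, h2] at h3
  exact ⟨corrCompactlyAligned p q S.1 S.2 T.1 T.2, h3⟩

/-- One `s` above all of `F` is enough. Reading the hypothesis in the component `X_s` of `X̃_s`
gives `∑ ι_p^s(T_p) = 0` in `K(X_s)`, and `ψ^{(s)}` turns this into the claim. -/
theorem isSimsYeendCovariant (hψ : ψ.IsCuntzPimsnerCovariant) : ψ.IsSimsYeendCovariant := by
  intro F T hF
  obtain ⟨s, hs, hsum⟩ := hF (F.sup id)
  have hle : ∀ p ∈ F, p ≤ s := fun p hp => (Finset.le_sup (f := id) hp).trans hs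
  have h0 : ∑ p ∈ F, D.kGraph.iota p s (T p) = 0 := by
    ext1 ζ
    obtain ⟨ξ, hξ⟩ := exists_tildeFib ζ
    have h1 := congrFun (hsum s le_rfl ξ) ⟨s, Set.mem_Iic.2 le_rfl⟩
    rw [Finset.sum_apply] at h1
    rw [_root_.sum_apply, ← hξ]
    exact h1
  have h2 : ∑ p ∈ F.attach, (⟨D.kGraph.iota p.1 s (T p.1), iota_mem_compacts (hle p.1 p.2) _⟩ :
      D.kGraph.compacts s) = 0 := by
    refine Subtype.ext ?_
    rw [← Finset.sum_attach] at h0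
    exact (map_sum (D.kGraph.compacts s).subtype _ _).trans h0
  rw [← Finset.sum_attach, ← map_zero (ψ.onCompacts s), ← h2, map_sum]
  exact Finset.sum_congr rfl fun p _ => (onCompacts_iota hψ (hle p.1 p.2) (T p.1)).symm

/-- The test family is `φ_0(a)` at `0` and `-φ_m(a)` at `m`. On `X̃_s` with `s ≥ m` only the
component `s` survives, and there both operators induce `±φ_s(a)`. -/
theorem isCuntzPimsnerCovariant (hψ : ψ.IsSimsYeendCovariant) : ψ.IsCuntzPimsnerCovariant := by
  classical
  intro m a ha _
  rw [← onCompacts_phi_zero ψ a]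
  -- For `m = 0` the two indices coincide and the test family degenerates, but the claim is then
  -- trivial.
  by_cases hm : m = 0
  · subst hm; rfl
  let T : ∀ p, D.kGraph.compacts p := fun p =>
    if p = 0 then ⟨D.kGraph.phi p a, phi_mem_compacts p a⟩
    else -⟨D.kGraph.phi p a, phi_mem_compacts p a⟩
  have hT0 : T 0 = ⟨D.kGraph.phi 0 a, phi_mem_compacts 0 a⟩ := if_pos rfl
  have hTm : T m = -⟨D.kGraph.phi m a, phi_mem_compacts m a⟩ := if_neg hm
  have h1 := hψ {0, m} T ?_
  · rw [Finset.sum_pair (Ne.symm hm), hT0, hTm, map_neg, add_neg_eq_zero] at h1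
    exact h1.symm
  · refine fun q => ⟨q ⊔ m, le_sup_left, fun s hs ξ => ?_⟩
    rw [Finset.sum_pair (Ne.symm hm)]
    funext r
    change D.kGraph.iota 0 r.1 (T 0).1 (ξ.1 r) + D.kGraph.iota m r.1 (T m).1 (ξ.1 r) = 0
    by_cases hr : r.1 = s
    · have hmr : m ≤ r.1 := (le_sup_right.trans hs).trans_eq hr.symm
      have h2 : D.kGraph.iota m r.1 (T m).1 = -D.kGraph.phi r.1 a := by
        rw [← iotaL_apply hmr (productsDense _), hTm, map_neg, iotaL_apply]
        exact congrArg Neg.neg (iota_phi hmr a)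
      rw [hT0, h2, iota_phi zero_le]
      exact add_neg_cancel _
    · rw [tildeFib_apply_eq_zero ξ r hr, map_zero, map_zero, add_zero]

end TopDynSystem

theorem proposition4p10 {k : ℕ} {Ω : Type*} [TopologicalSpace Ω] [LocallyCompactSpace Ω]
    [T2Space Ω] (D : TopDynSystem k Ω) {B : Type*} [NonUnitalCStarAlgebra B]
    (ψ : D.kGraph.ToeplitzRep B) :
    D.kGraph.CorrCompactlyAligned ∧ (∀ q, Function.Injective (D.kGraph.tildePhi q)) ∧
      (ψ.IsCuntzPimsnerCovariant ↔ ψ.IsCNPCovariant) :=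
  ⟨TopDynSystem.corrCompactlyAligned, TopDynSystem.tildePhi_injective,
    fun h => ⟨TopDynSystem.isSimsYeendCovariant h, TopDynSystem.isNicaCovariant h⟩,
    fun h => TopDynSystem.isCuntzPimsnerCovariant h.1⟩
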